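/- Let $L>0$ and let $f,h\colon\mathbb R\to\mathbb R$ be $C^1$ with $h>0$ on $[0,L]$. Consider the fracture of thickness $2h(u)$ that is a foliation of the cylindrical surface $r(u,v)=\langle u,v,f(u)\rangle$; since nothing depends on $v$, it is described in the coordinates $(u,\lambda)$ by $$\Omega_f=\{(u,\lambda): 0<u<L,\ -h(u)<\lambda<h(u)\},$$ with the $\lambda$-independent metric $g=\mathrm{diag}(1+f_u^2,\,1)$, volume element $d\mu=\sqrt{1+f_u^2}\,du\,d\lambda$, gradient $\nabla_g\varphi=\big(\tfrac{1}{1+f_u^2}\partial_u\varphi,\ \partial_\lambda\varphi\big)$ and $\nabla_{g_u}\varphi=\tfrac{1}{1+f_u^2}\partial_u\varphi$ (a tangent vector in the $u$-direction, so that $\|\nabla_{g_u}\varphi\|_g=|\partial_u\varphi|/\sqrt{1+f_u^2}$). All $L^p(\Omega_f)$ norms are taken with respect to $\mu$. Let $\Gamma_w=\{u=0,\ |\lambda|<h(0)\}$, $\Gamma_f^\pm=\{0<u<L,\ \lambda=\pm h(u)\}$, $\Gamma_{f_{out}}=\{u=L,\ |\lambda|<h(L)\}$, with unit outward normals $\mathbf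 n_f^\pm$ on $\Gamma_f^\pm$ and $\mathbf n$ on $\Gamma_{f_{out}}$ with respect to $g$. Let $\alpha,\beta>0$, $Q\in\mathbb R$, $|\Omega|>0$ and $$f_\beta(s)=\frac{2}{\alpha+\sqrt{\alpha^2+4\beta s}}.$$ For $q^\pm=q^\pm(u)\in L^3(0,L)$, let $W$ be a weak solution in $W^{1,3/2}(\Omega_f)$ of the actual problem $$-\nabla_g\cdot\big(f_\beta(\|\nabla_gW\|_g)\nabla_gW\big)=\frac{Q}{|\Omega|}\ \text{ in }\Omega_f,$$ $$\langle f_\beta(\|\nabla_gW\|_g)\nabla_gW,\mathbf n_f^\pm\rangle_g=q^\pm\ \text{ on }\Gamma_f^\pm,\qquad W=0\ \text{ on }\Gamma_w,\qquad \langle f_\beta(\|\nabla_gW\|_g)\nabla_gW,\mathbf n\rangle_g=0\ \text{ on }\Gamma_{f_{out}},$$ and let $\bar W$ be a $\lambda$-independent weak solution in $W^{1,3/2}(\Omega_f)$ of the reduced problem $$-\nabla_g\cdot\big(f_\beta(\|\nabla_g\bar W\|_g)\nabla_g\bar W\big)=\frac{Q}{|\Omega|}+\frac{q^++q^-}{2h}\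 \text{ in }\Omega_f,$$ $$\langle f_\beta(\|\nabla_g\bar W\|_g)\nabla_g\bar W,\mathbf n_f^\pm\rangle_g=0\ \text{ on }\Gamma_f^\pm,\qquad \bar W=0\ \text{ on }\Gamma_w,\qquad \langle f_\beta(\|\nabla_g\bar W\|_g)\nabla_g\bar W,\mathbf n\rangle_g=0\ \text{ on }\Gamma_{f_{out}}.$$ (Weak solutions are tested against smooth functions vanishing on $\Gamma_w$, and the condition on $\Gamma_w$ means that the solution is a limit in $W^{1,3/2}(\Omega_f)$ of such functions.) Then for every $M\ge 0$ there is a constant $C$, depending only on $L,f,h,\alpha,\beta,Q,|\Omega|$ and $M$, such that for all $q^\pm$ with $\|q^\pm\|_{L^3(\Omega_f)}\le M$ and all $W,\bar W$ as above, $$\big\|\nabla_{g_u}(W-\bar W)\big\|_{L^{3/2}(\Omega_f)}^2+\|W_\lambda\|_{L^{3/2}(\Omega_f)}^2\le C\left(\|q^+\|_{L^3(\Omega_f)}^2+\|q^-\|_{L^3(\Omega_f)}^2\right).$$ -/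

import Mathlib

open MeasureTheory Set Filter Topology
open scoped NNReal ENNReal ContDiff

noncomputable section

/-- The nonlinear Darcy--Forchheimer coefficient `f_β(s) = 2 / (α + √(α² + 4 β s))`. -/
def forchheimerCoeff (α β s : ℝ) : ℝ := 2 / (α + √(α ^ 2 + 4 * β * s))

/-- Geometric data of a fracture which is a foliation of the cylindrical surface
`r(u, v) = ⟨u, v, f(u)⟩`, of length `L` and thickness `2 h(u)`. -/
structure Fracture where
  /-- length in the parameter `u` -/
  L : ℝ
  /-- profile of the barycentric surface -/
  f : ℝ → ℝ
  /-- half thickness -/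
  h : ℝ → ℝ
  L_pos : 0 < L
  f_contDiff : ContDiff ℝ 1 f
  h_contDiff : ContDiff ℝ 1 h
  h_pos : ∀ u ∈ Icc 0 L, 0 < h u

namespace Fracture

/-- The barycentric surface `r(u, v) = ⟨u, v, f(u)⟩`. -/
def surface (F : Fracture) (u v : ℝ) : EuclideanSpace ℝ (Fin 3) := !₂[u, v, F.f u]

/-- The coefficient `g₁₁ = 1 + f_u²` of the metric. In the coordinates `(u, λ)` the
(`λ`-independent) metric of the fracture is `g = diag(1 + f_u², 1)`. -/
def g₁₁ (F : Fracture) (u : ℝ) : ℝ := 1 + deriv F.f u ^ 2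

/-- `g₁₁` is the coefficient `⟨r_u, r_u⟩` of the first fundamental form of the surface. -/
theorem inner_surface_u (F : Fracture) (u v : ℝ) :
    inner ℝ (deriv (fun s => F.surface s v) u) (deriv (fun s => F.surface s v) u) = F.g₁₁ u := by
  have hf : HasDerivAt F.f (deriv F.f u) u :=
    ((F.f_contDiff.differentiable one_ne_zero) u).hasDerivAt
  have h1 : HasDerivAt (fun s => (![s, v, F.f s] : Fin 3 → ℝ)) ![1, 0, deriv F.f u] u := by
    rw [hasDerivAt_pi]
    intro i
    fin_cases i
    · exact hasDerivAt_id u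
    · exact hasDerivAt_const u v
    · exact hf
  have h2 : HasDerivAt (fun s => F.surface s v) !₂[1, 0, deriv F.f u] u := by
    have := (PiLp.hasFDerivAt_toLp (𝕜 := ℝ) (E := fun _ : Fin 3 => ℝ) 2
      ![u, v, F.f u]).comp_hasDerivAt u h1
    exact this
  rw [h2.deriv, PiLp.inner_apply]
  simp [Fin.sum_univ_three, g₁₁, pow_two]

/-- The Riemannian inner product `⟨X, Y⟩_g` of tangent vectors at a point with first
coordinate `u`. -/
def gInner (F : Fracture) (u : ℝ) (X Y : ℝ × ℝ) : ℝ := F.g₁₁ u * X.1 * Y.1 + X.2 * Y.2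

/-- The Riemannian norm `‖X‖_g`. -/
def gNorm (F : Fracture) (u : ℝ) (X : ℝ × ℝ) : ℝ := √(F.gInner u X X)

/-- `∇_g = ⟨(1 + f_u²)⁻¹ ∂_u, ∂_λ⟩`, applied to a function with partial derivatives
`a = ∂_u φ` and `b = ∂_λ φ`. -/
def gGrad (F : Fracture) (u a b : ℝ) : ℝ × ℝ := (a / F.g₁₁ u, b)

/-- `∇_{g_u} = (1 + f_u²)⁻¹ ∂_u`, as a tangent vector. -/
def gGradU (F : Fracture) (u a : ℝ) : ℝ × ℝ := (a / F.g₁₁ u, 0)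

/-- The fracture `Ω_f = {0 < u < L, -h(u) < λ < h(u)}`. -/
def domain (F : Fracture) : Set (ℝ × ℝ) :=
  {x | 0 < x.1 ∧ x.1 < F.L ∧ -F.h x.1 < x.2 ∧ x.2 < F.h x.1}

/-- The well boundary `Γ_w = {u = 0, -h(0) < λ < h(0)}`. -/
def well (F : Fracture) : Set (ℝ × ℝ) :=
  {x | x.1 = 0 ∧ -F.h 0 < x.2 ∧ x.2 < F.h 0}

/-- The Riemannian volume `dμ = √|g| du dλ` on `Ω_f`. -/
def vol (F : Fracture) : Measure (ℝ × ℝ) :=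
  (volume.restrict F.domain).withDensity (fun x => ENNReal.ofReal (√(F.g₁₁ x.1)))

/-- For `s = 1` (resp. `s = -1`), the integral `∫_{Γ_f^±} w dμ̃` over the top (resp. bottom)
boundary `λ = s h(u)`, with respect to the Riemannian length of the curve `u ↦ (u, s h(u))`. -/
def edgeIntegral (F : Fracture) (s : ℝ) (w : ℝ × ℝ → ℝ) : ℝ :=
  ∫ u in 0..F.L, w (u, s * F.h u) * F.gNorm u (1, s * deriv F.h u)

/-- `∂_u φ` for a smooth function of `(u, λ)`. -/
def partialU (φ : ℝ × ℝ → ℝ) (x : ℝ × ℝ) : ℝ := fderiv ℝ φ x (1, 0)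

/-- `∂_λ φ` for a smooth function of `(u, λ)`. -/
def partialL (φ : ℝ × ℝ → ℝ) (x : ℝ × ℝ) : ℝ := fderiv ℝ φ x (0, 1)

/-- Smooth functions up to the boundary of the fracture that vanish on `Γ_w`. -/
def IsTest (F : Fracture) (φ : ℝ × ℝ → ℝ) : Prop :=
  ContDiff ℝ ∞ φ ∧ ∀ x ∈ F.well, φ x = 0

/-- `W` belongs to the Sobolev space `W^{1,3/2}(Ω_f)`, with weak partial derivatives
`Wu = ∂_u W` and `Wl = ∂_λ W`, and `W = 0` on `Γ_w`: it is a limit in `W^{1,3/2}(Ω_f)` of smooth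
functions that vanish on `Γ_w`. -/
structure IsSobolev (F : Fracture) (W Wu Wl : ℝ × ℝ → ℝ) : Prop where
  memLp : MemLp W (3 / 2) F.vol
  memLp_u : MemLp Wu (3 / 2) F.vol
  memLp_l : MemLp Wl (3 / 2) F.vol
  weak_u : ∀ ψ : ℝ × ℝ → ℝ, ContDiff ℝ ∞ ψ → HasCompactSupport ψ → tsupport ψ ⊆ F.domain →
    ∫ x in F.domain, W x * partialU ψ x = -∫ x in F.domain, Wu x * ψ x
  weak_l : ∀ ψ : ℝ × ℝ → ℝ, ContDiff ℝ ∞ ψ → HasCompactSupport ψ → tsupport ψ ⊆ F.domain →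
    ∫ x in F.domain, W x * partialL ψ x = -∫ x in F.domain, Wl x * ψ x
  zero_on_well : ∃ φ : ℕ → ℝ × ℝ → ℝ, (∀ n, F.IsTest (φ n)) ∧
    Tendsto (fun n => eLpNorm (fun x => φ n x - W x) (3 / 2) F.vol) atTop (𝓝 0) ∧
    Tendsto (fun n => eLpNorm (fun x => partialU (φ n) x - Wu x) (3 / 2) F.vol) atTop (𝓝 0) ∧
    Tendsto (fun n => eLpNorm (fun x => partialL (φ n) x - Wl x) (3 / 2) F.vol) atTop (𝓝 0)

/-- `∫_{Ω_f} ⟨f_β(‖∇_g W‖_g) ∇_g W, ∇_g φ⟩_g dμ`, where `Wu`, `Wl` are the partial derivatives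
of `W`. -/
def energyForm (F : Fracture) (α β : ℝ) (Wu Wl φ : ℝ × ℝ → ℝ) : ℝ :=
  ∫ x, forchheimerCoeff α β (F.gNorm x.1 (F.gGrad x.1 (Wu x) (Wl x))) *
    F.gInner x.1 (F.gGrad x.1 (Wu x) (Wl x)) (F.gGrad x.1 (partialU φ x) (partialL φ x)) ∂F.vol

/-- `W` (with partial derivatives `Wu`, `Wl`) is a weak solution of the actual model
`-∇_g · (f_β(‖∇_g W‖_g) ∇_g W) = Q / |Ω|` in `Ω_f`, with `W = 0` on `Γ_w`, outward flux
`⟨f_β(‖∇_g W‖_g) ∇_g W, n_f^±⟩_g` equal to `qp` on `Γ_f^+` and to `qm` on `Γ_f^-`, and zero flux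
at `u = L`. -/
structure IsActualSolution (F : Fracture) (α β Q volΩ : ℝ) (qp qm : ℝ → ℝ)
    (W Wu Wl : ℝ × ℝ → ℝ) : Prop where
  sobolev : F.IsSobolev W Wu Wl
  weak_eq : ∀ φ, F.IsTest φ →
    F.energyForm α β Wu Wl φ =
      (∫ x, Q / volΩ * φ x ∂F.vol)
        + F.edgeIntegral 1 (fun x => qp x.1 * φ x)
        + F.edgeIntegral (-1) (fun x => qm x.1 * φ x)

/-- `V` (with partial derivatives `Vu`, `Vl`) is a `λ`-independent weak solution of the reduced
model `-∇_g · (f_β(‖∇_g V‖_g) ∇_g V) = Q / |Ω| + (qp + qm) / (2 h)` in `Ω_f`, with `V = 0` on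
`Γ_w`, and zero flux on `Γ_f^±` and at `u = L`. -/
structure IsReducedSolution (F : Fracture) (α β Q volΩ : ℝ) (qp qm : ℝ → ℝ)
    (V Vu Vl : ℝ × ℝ → ℝ) : Prop where
  sobolev : F.IsSobolev V Vu Vl
  indep : ∃ v : ℝ → ℝ, V =ᵐ[F.vol] fun x => v x.1
  weak_eq : ∀ φ, F.IsTest φ →
    F.energyForm α β Vu Vl φ =
      ∫ x, (Q / volΩ + (qp x.1 + qm x.1) / (2 * F.h x.1)) * φ x ∂F.vol

end Fracture

end

/-! The flux $p=f_\beta(\|x\|)x$ inverts $x=(\alpha+\beta\|p\|)p$. This inverse map is strongly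
monotone and locally Lipschitz, both with weight $D=\alpha+\beta(\|p\|+\|q\|)$, so for gradients
$x,y$ with fluxes $p,q$ one gets $\|x-y\|^2\le 2D\,\langle p-q,x-y\rangle$
(`forchheimerFlux_coercive`). Taking square roots and applying Hölder with
$\tfrac16+\tfrac12=\tfrac23$ gives $\|X-Y\|_{3/2}^2\le\|2D\|_3\int\langle P-R,X-Y\rangle$
(`eLpNorm_sub_sq_le_forchheimer`).

For $X=\nabla W$ and $Y=\nabla\bar W$ the integral is the difference of the two weak formulations
tested with $W-\bar W$. The $Q$ terms cancel. What remains, the edge integrals of $q^\pm$ and the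
sources $q^\pm/(2h)$, is at most $C(\|q^+\|_3+\|q^-\|_3)\|X-Y\|_{3/2}$ by Hölder and a Poincaré and
trace inequality for functions vanishing on the well (`exists_energyForm_bounds`). One factor
$\|X-Y\|_{3/2}$ then cancels.

The factor $\|2D\|_3$ is where $M$ enters. Since $\beta\|p\|^2\le\|x\|$, a flux in $L^3$ costs only
the square root of the gradient norm in $L^{3/2}$, so testing each equation with its own solution
bounds both gradients in terms of $M$ (`eLpNorm_le_of_enorm_integral_flux_le`).

Finally $\bar W_\lambda=0$ (`ae_eq_zero_of_indep`), so $W_\lambda$ is a component of $X-Y$, and so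
is the $u$-part of the gradient difference. -/

/-! ### The Forchheimer map `x ↦ f_β(‖x‖) x` -/

section Forchheimer

variable {E : Type*} [NormedAddCommGroup E] [InnerProductSpace ℝ E]

/-- The flux `f_β(‖x‖) x` associated with a gradient `x`. -/
noncomputable def forchheimerFlux (α β : ℝ) (x : E) : E := forchheimerCoeff α β ‖x‖ • x

theorem forchheimerCoeff_pos {α β s : ℝ} (hα : 0 < α) : 0 < forchheimerCoeff α β s := by
  unfold forchheimerCoeff
  positivity

/-- The coefficient is the positive root $c$ of $\beta s\,c^2+\alpha c=1$, written with the square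
root in the denominator so that $s=0$ is included. -/
theorem forchheimerCoeff_equation {α β s : ℝ} (hα : 0 < α) (hβ : 0 < β) (hs : 0 ≤ s) :
    (α + β * (forchheimerCoeff α β s * s)) * forchheimerCoeff α β s = 1 := by
  unfold forchheimerCoeff
  have h := Real.sq_sqrt (show 0 ≤ α ^ 2 + 4 * β * s by positivity)
  set r := √(α ^ 2 + 4 * β * s)
  have hr : 0 ≤ r := Real.sqrt_nonneg _
  have : α + r ≠ 0 := by positivity
  field_simp
  nlinarith

theorem norm_forchheimerFlux {α β : ℝ} (hα : 0 < α) (x : E) :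
    ‖forchheimerFlux α β x‖ = forchheimerCoeff α β ‖x‖ * ‖x‖ := by
  rw [forchheimerFlux, norm_smul, Real.norm_of_nonneg (forchheimerCoeff_pos hα).le]

/-- The flux `p` of a gradient `x` satisfies the Forchheimer equation `α p + β ‖p‖ p = x`. -/
theorem forchheimerFlux_equation {α β : ℝ} (hα : 0 < α) (hβ : 0 < β) (x : E) :
    (α + β * ‖forchheimerFlux α β x‖) • forchheimerFlux α β x = x := by
  rw [norm_forchheimerFlux hα, forchheimerFlux, smul_smul,
    forchheimerCoeff_equation hα hβ (norm_nonneg x), one_smul]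

theorem norm_forchheimerFlux_sq_le {α β : ℝ} (hα : 0 < α) (hβ : 0 < β) (x : E) :
    β * ‖forchheimerFlux α β x‖ ^ 2 ≤ ‖x‖ := by
  have h := congrArg norm (forchheimerFlux_equation hα hβ x)
  rw [norm_smul, Real.norm_of_nonneg (by positivity)] at h
  nlinarith [norm_nonneg (forchheimerFlux α β x)]

/-- With $D=\alpha+\beta(\|p\|+\|q\|)$, the difference of the two vectors has norm at most
$D\|p-q\|$, and its pairing with $p-q$ is at least $\tfrac D2\|p-q\|^2$. Eliminating $\|p-q\|$ gives
the bound. -/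
theorem forchheimer_coercive_aux {α β : ℝ} (hα : 0 < α) (hβ : 0 < β) (p q : E) :
    ‖(α + β * ‖p‖) • p - (α + β * ‖q‖) • q‖ ^ 2 ≤
      2 * (α + β * (‖p‖ + ‖q‖)) *
        inner ℝ (p - q) ((α + β * ‖p‖) • p - (α + β * ‖q‖) • q) := by
  have hp := norm_nonneg p
  have hq := norm_nonneg q
  set D := α + β * (‖p‖ + ‖q‖) with hD
  have hD0 : 0 < D := by positivity
  have h1 : D / 2 * ‖p - q‖ ^ 2 ≤
      inner ℝ (p - q) ((α + β * ‖p‖) • p - (α + β * ‖q‖) • q) := by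
    have e1 : ‖p - q‖ ^ 2 = ‖p‖ ^ 2 - 2 * inner ℝ p q + ‖q‖ ^ 2 := norm_sub_sq_real p q
    have e2 : inner ℝ (p - q) ((α + β * ‖p‖) • p - (α + β * ‖q‖) • q) =
        (α + β * ‖p‖) * ‖p‖ ^ 2 + (α + β * ‖q‖) * ‖q‖ ^ 2
          - (2 * α + β * (‖p‖ + ‖q‖)) * inner ℝ p q := by
      simp only [inner_sub_left, inner_sub_right, inner_smul_right, real_inner_self_eq_norm_sq,
        real_inner_comm p q]
      ring
    have e3 : 0 ≤ ‖p - q‖ ^ 2 := by positivity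
    -- The pairing equals $(\alpha+\tfrac\beta2(\|p\|+\|q\|))\|p-q\|^2$ plus exactly this term.
    have e4 : 0 ≤ β / 2 * ((‖p‖ + ‖q‖) * (‖p‖ - ‖q‖) ^ 2) := by positivity
    rw [e2]
    rw [e1] at e3 ⊢
    nlinarith
  have h2 : ‖(α + β * ‖p‖) • p - (α + β * ‖q‖) • q‖ ≤ D * ‖p - q‖ := by
    have e : (α + β * ‖p‖) • p - (α + β * ‖q‖) • q =
        (α + β * ‖p‖) • (p - q) + (β * (‖p‖ - ‖q‖)) • q := by
      simp only [smul_sub, add_smul, mul_sub, sub_smul]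
      abel
    rw [e]
    refine (norm_add_le _ _).trans ?_
    rw [norm_smul, norm_smul, Real.norm_of_nonneg (show 0 ≤ α + β * ‖p‖ by positivity), norm_mul,
      Real.norm_of_nonneg hβ.le]
    have h3 : ‖‖p‖ - ‖q‖‖ ≤ ‖p - q‖ := abs_norm_sub_norm_le p q
    have h4 : β * ‖‖p‖ - ‖q‖‖ * ‖q‖ ≤ β * ‖p - q‖ * ‖q‖ := by gcongr
    rw [hD]
    linarith
  calc _ ≤ (D * ‖p - q‖) ^ 2 := by gcongr
    _ = 2 * D * (D / 2 * ‖p - q‖ ^ 2) := by ring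
    _ ≤ _ := by gcongr

theorem forchheimerFlux_coercive {α β : ℝ} (hα : 0 < α) (hβ : 0 < β) (x y : E) :
    ‖x - y‖ ^ 2 ≤ 2 * (α + β * (‖forchheimerFlux α β x‖ + ‖forchheimerFlux α β y‖)) *
      inner ℝ (forchheimerFlux α β x - forchheimerFlux α β y) (x - y) := by
  have h := forchheimer_coercive_aux hα hβ (forchheimerFlux α β x) (forchheimerFlux α β y)
  rwa [forchheimerFlux_equation hα hβ, forchheimerFlux_equation hα hβ] at h

theorem inner_forchheimerFlux_nonneg {α β : ℝ} (hα : 0 < α) (hβ : 0 < β) (x y : E) :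
    0 ≤ inner ℝ (forchheimerFlux α β x - forchheimerFlux α β y) (x - y) :=
  nonneg_of_mul_nonneg_right ((sq_nonneg _).trans (forchheimerFlux_coercive hα hβ x y))
    (by positivity)

theorem continuous_forchheimerFlux {α β : ℝ} (hα : 0 < α) :
    Continuous (forchheimerFlux α β : E → E) := by
  unfold forchheimerFlux forchheimerCoeff
  refine Continuous.smul (continuous_const.div (by fun_prop) fun x => ?_) continuous_id
  positivity

@[simp] theorem forchheimerFlux_zero (α β : ℝ) : forchheimerFlux α β (0 : E) = 0 := by
  simp [forchheimerFlux]

end Forchheimer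

/-! ### The pairing of `L³` and `L^{3/2}` -/

section Pairing

theorem ENNReal.three_div_two_ne_zero : (3 / 2 : ℝ≥0∞) ≠ 0 := by simp

theorem ENNReal.three_div_two_ne_top : (3 / 2 : ℝ≥0∞) ≠ ⊤ :=
  ENNReal.div_ne_top (by simp) (by simp)

theorem ENNReal.one_le_three_div_two : (1 : ℝ≥0∞) ≤ 3 / 2 := by
  rw [ENNReal.le_div_iff_mul_le (by simp) (by simp)]
  norm_num

theorem ENNReal.toReal_three_div_two : (3 / 2 : ℝ≥0∞).toReal = 3 / 2 := by simp

instance ENNReal.holderTriple_three : ENNReal.HolderTriple 3 (3 / 2) 1 where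
  inv_add_inv_eq_inv := by
    rw [ENNReal.inv_div (by simp) (by simp), ← one_div, ENNReal.div_add_div_same, inv_one,
      show (1 + 2 : ℝ≥0∞) = 3 by norm_num]
    exact ENNReal.div_self (by simp) (by simp)

/-- Used to estimate a product $D^{1/2}I^{1/2}$ with $D\in L^3$ and $I\in L^1$. -/
instance ENNReal.holderTriple_six_two : ENNReal.HolderTriple 6 2 (3 / 2) where
  inv_add_inv_eq_inv := by
    rw [ENNReal.inv_div (by simp) (by simp)]
    rw [← ENNReal.toReal_eq_toReal_iff' (by simp) (ENNReal.div_ne_top (by simp) (by simp)),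
      ENNReal.toReal_add (by simp) (by simp)]
    simp
    norm_num

variable {X E : Type*} [MeasurableSpace X] {μ : Measure X}
  [NormedAddCommGroup E] [InnerProductSpace ℝ E]

theorem lintegral_enorm_mul_le {E F : Type*} [NormedAddCommGroup E] [NormedAddCommGroup F]
    {P : X → E} {Y : X → F} (hP : AEStronglyMeasurable P μ) (hY : AEStronglyMeasurable Y μ) :
    ∫⁻ x, ‖P x‖ₑ * ‖Y x‖ₑ ∂μ ≤ eLpNorm P 3 μ * eLpNorm Y (3 / 2) μ := by
  have h := eLpNorm_smul_le_mul_eLpNorm (p := 3) (q := 3 / 2) (r := 1) hY.norm hP.norm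
  rw [eLpNorm_norm, eLpNorm_norm, eLpNorm_one_eq_lintegral_enorm] at h
  refine le_trans (le_of_eq ?_) h
  simp [enorm_mul]

theorem enorm_integral_inner_le {P Y : X → E} (hP : AEStronglyMeasurable P μ)
    (hY : AEStronglyMeasurable Y μ) :
    ‖∫ x, inner ℝ (P x) (Y x) ∂μ‖ₑ ≤ eLpNorm P 3 μ * eLpNorm Y (3 / 2) μ := by
  refine (enorm_integral_le_lintegral_enorm _).trans
    (le_trans (lintegral_mono fun x => ?_) (lintegral_enorm_mul_le hP hY))
  rw [← ofReal_norm, ← ofReal_norm, ← ofReal_norm, ← ENNReal.ofReal_mul (norm_nonneg _)]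
  exact ENNReal.ofReal_le_ofReal (norm_inner_le_norm _ _)

theorem integrable_inner_of_memLp {P Y : X → E} (hP : MemLp P 3 μ) (hY : MemLp Y (3 / 2) μ) :
    Integrable (fun x => inner ℝ (P x) (Y x)) μ := by
  refine (MemLp.integrable_mul hP.norm hY.norm).mono (hP.1.inner hY.1) (ae_of_all _ fun x => ?_)
  simpa using norm_inner_le_norm (𝕜 := ℝ) (P x) (Y x)

/-- A bound on the pairing with `P` that holds along a sequence converging in `L^{3/2}` passes to
the limit. -/
theorem enorm_integral_inner_le_of_tendsto {P Y : X → E} {Yn : ℕ → X → E} {K : ℝ≥0∞}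
    (hK : K ≠ ⊤) (hP : MemLp P 3 μ) (hY : MemLp Y (3 / 2) μ) (hYn : ∀ n, MemLp (Yn n) (3 / 2) μ)
    (hlim : Tendsto (fun n => eLpNorm (Yn n - Y) (3 / 2) μ) atTop (𝓝 0))
    (hb : ∀ n, ‖∫ x, inner ℝ (P x) (Yn n x) ∂μ‖ₑ ≤ K * eLpNorm (Yn n) (3 / 2) μ) :
    ‖∫ x, inner ℝ (P x) (Y x) ∂μ‖ₑ ≤ K * eLpNorm Y (3 / 2) μ := by
  have key : ∀ n, ‖∫ x, inner ℝ (P x) (Y x) ∂μ‖ₑ ≤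
      K * (eLpNorm (Yn n - Y) (3 / 2) μ + eLpNorm Y (3 / 2) μ)
        + eLpNorm P 3 μ * eLpNorm (Yn n - Y) (3 / 2) μ := by
    intro n
    have e : ∫ x, inner ℝ (P x) (Y x) ∂μ = ∫ x, inner ℝ (P x) (Yn n x) ∂μ
        - ∫ x, inner ℝ (P x) ((Yn n - Y) x) ∂μ := by
      rw [← integral_sub (integrable_inner_of_memLp hP (hYn n))
        (integrable_inner_of_memLp hP ((hYn n).sub hY))]
      simp [inner_sub_right]
    rw [e]
    refine (enorm_sub_le).trans (add_le_add ((hb n).trans ?_)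
      (enorm_integral_inner_le hP.1 ((hYn n).1.sub hY.1)))
    gcongr
    have := eLpNorm_add_le ((hYn n).1.sub hY.1) hY.1 ENNReal.one_le_three_div_two
    simpa using this
  have hl : Tendsto (fun n => K * (eLpNorm (Yn n - Y) (3 / 2) μ + eLpNorm Y (3 / 2) μ)
        + eLpNorm P 3 μ * eLpNorm (Yn n - Y) (3 / 2) μ) atTop
      (𝓝 (K * (0 + eLpNorm Y (3 / 2) μ) + eLpNorm P 3 μ * 0)) :=
    (ENNReal.Tendsto.const_mul (hlim.add_const _) (Or.inr hK)).add
      (ENNReal.Tendsto.const_mul hlim (Or.inr hP.2.ne))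
  rw [zero_add, mul_zero, add_zero] at hl
  exact ge_of_tendsto' hl key

/-! ### The flux as a map from $L^{3/2}$ to $L^3$, and coercivity in integral form -/

theorem eLpNorm_forchheimerFlux_le {α β : ℝ} (hα : 0 < α) (hβ : 0 < β) (Y : X → E) :
    eLpNorm (fun x => forchheimerFlux α β (Y x)) 3 μ ≤
      ENNReal.ofReal (β ^ (-(1 / 2) : ℝ)) * eLpNorm Y (3 / 2) μ ^ (1 / 2 : ℝ) := by
  have h : eLpNorm (fun x => forchheimerFlux α β (Y x)) 3 μ ≤
      eLpNorm ((β ^ (-(1 / 2) : ℝ)) • fun x => ‖Y x‖ ^ (1 / 2 : ℝ)) 3 μ := by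
    refine eLpNorm_mono fun x => ?_
    have h1 := norm_forchheimerFlux_sq_le hα hβ (Y x)
    have h2 : 0 ≤ β ^ (-(1 / 2) : ℝ) * ‖Y x‖ ^ (1 / 2 : ℝ) := by positivity
    rw [Pi.smul_apply, smul_eq_mul, Real.norm_of_nonneg h2]
    refine (sq_le_sq₀ (norm_nonneg _) h2).1 ?_
    rw [mul_pow, ← Real.rpow_natCast (β ^ (-(1 / 2) : ℝ)),
      ← Real.rpow_natCast (‖Y x‖ ^ (1 / 2 : ℝ)), ← Real.rpow_mul hβ.le, ← Real.rpow_mul (norm_nonneg _)]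
    norm_num
    rw [Real.rpow_neg_one, inv_mul_eq_div, le_div_iff₀ hβ]
    linarith
  refine h.trans (le_of_eq ?_)
  rw [eLpNorm_const_smul, eLpNorm_norm_rpow _ (by norm_num), Real.enorm_of_nonneg (by positivity)]
  congr 3
  rw [ENNReal.ofReal_div_of_pos (by norm_num)]
  simp [div_eq_mul_inv]

theorem memLp_forchheimerFlux {α β : ℝ} (hα : 0 < α) (hβ : 0 < β) {Y : X → E}
    (hY : MemLp Y (3 / 2) μ) : MemLp (fun x => forchheimerFlux α β (Y x)) 3 μ :=
  ⟨(continuous_forchheimerFlux hα).comp_aestronglyMeasurable hY.1,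
    (eLpNorm_forchheimerFlux_le hα hβ Y).trans_lt (ENNReal.mul_lt_top ENNReal.ofReal_lt_top
      (ENNReal.rpow_lt_top_of_nonneg (by norm_num) hY.2.ne))⟩

theorem eLpNorm_sub_sq_le_forchheimer {α β : ℝ} (hα : 0 < α) (hβ : 0 < β) {Y Z : X → E}
    (hY : MemLp Y (3 / 2) μ) (hZ : MemLp Z (3 / 2) μ) :
    eLpNorm (Y - Z) (3 / 2) μ ^ 2 ≤
      2 * (ENNReal.ofReal α * μ univ ^ (1 / 3 : ℝ) + ENNReal.ofReal β *
        (eLpNorm (fun x => forchheimerFlux α β (Y x)) 3 μ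
          + eLpNorm (fun x => forchheimerFlux α β (Z x)) 3 μ)) *
      ‖∫ x, inner ℝ (forchheimerFlux α β (Y x) - forchheimerFlux α β (Z x)) ((Y - Z) x) ∂μ‖ₑ := by
  set P := fun x => forchheimerFlux α β (Y x) with hPdef
  set R := fun x => forchheimerFlux α β (Z x) with hRdef
  have hP : MemLp P 3 μ := memLp_forchheimerFlux hα hβ hY
  have hR : MemLp R 3 μ := memLp_forchheimerFlux hα hβ hZ
  set D : X → ℝ := fun x => 2 * (α + β * (‖P x‖ + ‖R x‖)) with hD
  set I : X → ℝ := fun x => inner ℝ (P x - R x) ((Y - Z) x) with hI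
  have hI0 : ∀ x, 0 ≤ I x := fun x => inner_forchheimerFlux_nonneg hα hβ (Y x) (Z x)
  have hIint : Integrable I μ := integrable_inner_of_memLp (hP.sub hR) (hY.sub hZ)
  have hDm : AEStronglyMeasurable D μ :=
    (aestronglyMeasurable_const.add ((hP.1.norm.add hR.1.norm).const_mul β)).const_mul 2
  have hD0 : ∀ x, 0 ≤ D x := fun x => by positivity
  -- Monotonicity makes the integrand nonnegative, so its $L^1$ norm is the integral itself, the
  -- quantity that the weak formulations control.
  have hI1 : eLpNorm I 1 μ = ‖∫ x, I x ∂μ‖ₑ := by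
    rw [eLpNorm_one_eq_lintegral_enorm, Real.enorm_of_nonneg (integral_nonneg hI0),
      ofReal_integral_eq_lintegral_ofReal hIint (ae_of_all _ hI0)]
    exact lintegral_congr fun x => Real.enorm_of_nonneg (hI0 x)
  have hD3 : eLpNorm D 3 μ ≤ 2 * (ENNReal.ofReal α * μ univ ^ (1 / 3 : ℝ) + ENNReal.ofReal β *
      (eLpNorm P 3 μ + eLpNorm R 3 μ)) := by
    have e : D = (2 : ℝ) • ((fun _ => α) + β • ((fun x => ‖P x‖) + fun x => ‖R x‖)) := by
      ext x
      simp [hD, mul_add]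
    rw [e, eLpNorm_const_smul]
    have h2 : ‖(2 : ℝ)‖ₑ = 2 := by rw [Real.enorm_of_nonneg (by norm_num)]; simp
    rw [h2]
    gcongr
    refine (eLpNorm_add_le aestronglyMeasurable_const
      ((hP.1.norm.add hR.1.norm).const_smul β) (by norm_num)).trans ?_
    gcongr
    · rw [eLpNorm_const' _ (by simp) (by simp), Real.enorm_of_nonneg hα.le]
      simp
    · rw [eLpNorm_const_smul, Real.enorm_of_nonneg hβ.le]
      gcongr
      refine (eLpNorm_add_le hP.1.norm hR.1.norm (by norm_num)).trans ?_
      rw [eLpNorm_norm, eLpNorm_norm]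
  have hZ' : eLpNorm (Y - Z) (3 / 2) μ ≤
      eLpNorm D 3 μ ^ (1 / 2 : ℝ) * eLpNorm I 1 μ ^ (1 / 2 : ℝ) := by
    have a1 := eLpNorm_norm_rpow (p := 6) (μ := μ) D (q := 1 / 2) (by norm_num)
    have a2 := eLpNorm_norm_rpow (p := 2) (μ := μ) I (q := 1 / 2) (by norm_num)
    have b : ENNReal.ofReal (1 / 2) = 2⁻¹ := by
      rw [ENNReal.ofReal_div_of_pos (by norm_num)]; simp
    have b1 : (6 : ℝ≥0∞) * 2⁻¹ = 3 := by
      rw [show (6 : ℝ≥0∞) = 3 * 2 by norm_num, mul_assoc, ENNReal.mul_inv_cancel (by simp) (by simp),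
        mul_one]
    rw [b, b1] at a1
    rw [b, ENNReal.mul_inv_cancel (by simp) (by simp)] at a2
    rw [← a1, ← a2]
    refine le_trans (eLpNorm_mono fun x => ?_) (eLpNorm_smul_le_mul_eLpNorm (p := 6) (q := 2)
      (r := 3 / 2) (f := fun x => ‖I x‖ ^ (1 / 2 : ℝ)) (φ := fun x => ‖D x‖ ^ (1 / 2 : ℝ))
      ?_ ?_)
    · rw [Pi.smul_apply', smul_eq_mul, ← Real.mul_rpow (norm_nonneg _) (norm_nonneg _),
        ← Real.sqrt_eq_rpow, Real.norm_of_nonneg (Real.sqrt_nonneg _)]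
      refine Real.le_sqrt_of_sq_le ?_
      rw [Real.norm_of_nonneg (hD0 x), Real.norm_of_nonneg (hI0 x)]
      exact forchheimerFlux_coercive hα hβ (Y x) (Z x)
    · exact (Real.continuous_rpow_const (by norm_num)).comp_aestronglyMeasurable hIint.1.norm
    · exact (Real.continuous_rpow_const (by norm_num)).comp_aestronglyMeasurable hDm.norm
  calc eLpNorm (Y - Z) (3 / 2) μ ^ 2
      ≤ (eLpNorm D 3 μ ^ (1 / 2 : ℝ) * eLpNorm I 1 μ ^ (1 / 2 : ℝ)) ^ 2 := by gcongr
    _ = eLpNorm D 3 μ * eLpNorm I 1 μ := by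
        rw [mul_pow, ← ENNReal.rpow_natCast, ← ENNReal.rpow_natCast (_ ^ (1 / 2 : ℝ)),
          ← ENNReal.rpow_mul, ← ENNReal.rpow_mul]
        norm_num
    _ ≤ _ := by
        rw [hI1]
        gcongr

end Pairing

/-! ### Geometry of the fracture -/

namespace Fracture

variable (F : Fracture)

theorem g₁₁_pos (u : ℝ) : 0 < F.g₁₁ u := by
  unfold g₁₁
  positivity

theorem one_le_sqrt_g₁₁ (u : ℝ) : 1 ≤ √(F.g₁₁ u) := by
  rw [Real.one_le_sqrt, g₁₁]
  nlinarith [sq_nonneg (deriv F.f u)]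

theorem continuous_g₁₁ : Continuous F.g₁₁ := by
  have := F.f_contDiff.continuous_deriv le_rfl
  unfold g₁₁
  fun_prop

theorem continuous_h : Continuous F.h := F.h_contDiff.continuous

theorem continuous_deriv_h : Continuous (deriv F.h) := F.h_contDiff.continuous_deriv le_rfl

theorem hasDerivAt_h (u : ℝ) : HasDerivAt F.h (deriv F.h u) u :=
  ((F.h_contDiff.differentiable one_ne_zero) u).hasDerivAt

theorem exists_le_h : ∃ c : ℝ≥0, 0 < c ∧ ∀ u ∈ Icc 0 F.L, (c : ℝ) ≤ F.h u := by
  obtain ⟨u, hu, hmin⟩ := isCompact_Icc.exists_isMinOn (nonempty_Icc.2 F.L_pos.le)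
    F.continuous_h.continuousOn
  refine ⟨(F.h u).toNNReal, Real.toNNReal_pos.2 (F.h_pos u hu), fun v hv => ?_⟩
  rw [Real.coe_toNNReal _ (F.h_pos u hu).le]
  exact hmin hv

theorem exists_bound : ∃ B : ℝ≥0, 1 ≤ B ∧ ∀ u ∈ Icc 0 F.L, F.h u ≤ B ∧ |deriv F.h u| ≤ B ∧
    √(F.g₁₁ u) ≤ B ∧ F.gNorm u (1, deriv F.h u) ≤ B := by
  -- All the quantities to be bounded are dominated by summands of one continuous function with
  -- nonnegative terms, so its maximum on $[0,L]$ serves for all of them.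
  have hc : Continuous fun u => 1 + |F.h u| + |deriv F.h u| + √(F.g₁₁ u)
      + √(F.g₁₁ u + deriv F.h u * deriv F.h u) := by
    have h1 := F.continuous_h
    have h2 := F.continuous_deriv_h
    have h3 := F.continuous_g₁₁
    fun_prop
  obtain ⟨w, hw, hmax⟩ := isCompact_Icc.exists_isMaxOn (nonempty_Icc.2 F.L_pos.le)
    hc.continuousOn
  have hb : 0 ≤ 1 + |F.h w| + |deriv F.h w| + √(F.g₁₁ w)
      + √(F.g₁₁ w + deriv F.h w * deriv F.h w) := by positivity
  refine ⟨Real.toNNReal (1 + |F.h w| + |deriv F.h w| + √(F.g₁₁ w)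
    + √(F.g₁₁ w + deriv F.h w * deriv F.h w)), ?_, fun u hu => ?_⟩
  · rw [← NNReal.coe_le_coe, Real.coe_toNNReal _ hb]
    have := Real.sqrt_nonneg (F.g₁₁ w)
    have := Real.sqrt_nonneg (F.g₁₁ w + deriv F.h w * deriv F.h w)
    have := abs_nonneg (F.h w)
    have := abs_nonneg (deriv F.h w)
    simp only [NNReal.coe_one]
    linarith
  · have hm := hmax hu
    simp only [mem_ofPred_eq] at hm
    have := Real.sqrt_nonneg (F.g₁₁ u)
    have := Real.sqrt_nonneg (F.g₁₁ u + deriv F.h u * deriv F.h u)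
    have := abs_nonneg (F.h u)
    have := abs_nonneg (deriv F.h u)
    have := le_abs_self (F.h u)
    simp only [Real.coe_toNNReal _ hb, gNorm, gInner, mul_one]
    refine ⟨?_, ?_, ?_, ?_⟩ <;> linarith

/-! ### The domain, its volume, and flattening to a rectangle -/

theorem isOpen_domain : IsOpen F.domain := by
  have := F.continuous_h
  simp only [domain, ofPred_and]
  refine IsOpen.inter ?_ (IsOpen.inter ?_ (IsOpen.inter ?_ ?_))
  all_goals exact isOpen_lt (by fun_prop) (by fun_prop)

theorem measurableSet_domain : MeasurableSet F.domain := F.isOpen_domain.measurableSet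

theorem lintegral_Ioo_neg {a : ℝ} (ha : 0 < a) (g : ℝ → ℝ≥0∞) :
    ∫⁻ y in Ioo (-a) a, g y = ∫⁻ t in Ioo (-1) 1, ENNReal.ofReal a * g (t * a) := by
  have himg : (fun t => t * a) '' Ioo (-1) 1 = Ioo (-a) a := by
    rw [image_mul_right_Ioo _ _ ha]
    simp
  rw [← himg, lintegral_image_eq_lintegral_abs_deriv_mul measurableSet_Ioo
    (f' := fun _ => a)
    (fun t _ => by simpa using ((hasDerivAt_id t).mul_const a).hasDerivWithinAt)
    (fun x _ y _ hxy => mul_right_cancel₀ ha.ne' hxy)]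
  simp [abs_of_pos ha]

/-- The substitution $\lambda=t\,h(u)$ on each fibre straightens the fracture to
$(0,L)\times(-1,1)$, with density $h\sqrt{g_{11}}$. Bounds on this density from below and above then
compare norms on the fracture with norms on the rectangle. -/
theorem lintegral_vol {g : ℝ × ℝ → ℝ≥0∞} (hg : Measurable g) :
    ∫⁻ x, g x ∂F.vol = ∫⁻ u in Ioo 0 F.L, ∫⁻ t in Ioo (-1) 1,
      ENNReal.ofReal (F.h u * √(F.g₁₁ u)) * g (u, t * F.h u) := by
  have hw : Measurable fun x : ℝ × ℝ => ENNReal.ofReal (√(F.g₁₁ x.1)) := by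
    have := F.continuous_g₁₁
    fun_prop
  rw [vol, lintegral_withDensity_eq_lintegral_mul _ hw hg, ← lintegral_indicator
    F.measurableSet_domain, Measure.volume_eq_prod, lintegral_prod _
    ((hw.mul hg).indicator F.measurableSet_domain).aemeasurable,
    ← lintegral_indicator measurableSet_Ioo]
  refine lintegral_congr fun u => ?_
  by_cases hu : u ∈ Ioo 0 F.L
  · have hp := F.h_pos u (Ioo_subset_Icc_self hu)
    rw [indicator_of_mem hu]
    simp_rw [ENNReal.ofReal_mul hp.le, mul_assoc]
    rw [← lintegral_Ioo_neg hp (fun y => ENNReal.ofReal (√(F.g₁₁ u)) * g (u, y)),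
      ← lintegral_indicator measurableSet_Ioo]
    refine lintegral_congr fun y => ?_
    by_cases hy : y ∈ Ioo (-F.h u) (F.h u)
    · rw [indicator_of_mem hy, indicator_of_mem (show (u, y) ∈ F.domain from
        ⟨hu.1, hu.2, hy.1, hy.2⟩)]
      rfl
    · rw [indicator_of_notMem hy, indicator_of_notMem]
      exact fun h => hy ⟨h.2.2.1, h.2.2.2⟩
  · rw [indicator_of_notMem hu]
    refine (lintegral_congr fun y => ?_).trans lintegral_zero
    rw [indicator_of_notMem]
    exact fun h => hu ⟨h.1, h.2.1⟩

theorem measurable_scaled {g : ℝ × ℝ → ℝ≥0∞} (hg : Measurable g) :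
    Measurable fun y : ℝ × ℝ => g (y.1, y.2 * F.h y.1) := by
  have := F.continuous_h
  exact hg.comp (by fun_prop)

theorem lintegral_scaled_le {c : ℝ≥0} (hc : 0 < c) (hcF : ∀ u ∈ Icc 0 F.L, (c : ℝ) ≤ F.h u)
    {g : ℝ × ℝ → ℝ≥0∞} (hg : Measurable g) :
    ∫⁻ u in Ioo 0 F.L, ∫⁻ t in Ioo (-1) 1, g (u, t * F.h u) ≤ (c : ℝ≥0∞)⁻¹ * ∫⁻ x, g x ∂F.vol := by
  rw [← ENNReal.div_eq_inv_mul, ENNReal.le_div_iff_mul_le (Or.inl (by simpa using hc.ne'))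
    (Or.inl (by simp)), mul_comm, F.lintegral_vol hg, ← lintegral_const_mul' _ _ (by simp)]
  refine setLIntegral_mono' measurableSet_Ioo fun u hu => ?_
  rw [← lintegral_const_mul' _ _ (by simp)]
  refine lintegral_mono fun t => ?_
  dsimp only
  gcongr
  rw [← ENNReal.ofReal_coe_nnreal]
  refine ENNReal.ofReal_le_ofReal ?_
  have := hcF u (Ioo_subset_Icc_self hu)
  nlinarith [F.one_le_sqrt_g₁₁ u, c.coe_nonneg]

theorem lintegral_vol_le {B : ℝ≥0} (hB : ∀ u ∈ Icc 0 F.L, F.h u ≤ B ∧ √(F.g₁₁ u) ≤ B)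
    {g : ℝ × ℝ → ℝ≥0∞} (hg : Measurable g) :
    ∫⁻ x, g x ∂F.vol ≤ (B : ℝ≥0∞) ^ 2 *
      ∫⁻ u in Ioo 0 F.L, ∫⁻ t in Ioo (-1) 1, g (u, t * F.h u) := by
  rw [F.lintegral_vol hg, ← lintegral_const_mul' _ _ (by simp)]
  refine setLIntegral_mono' measurableSet_Ioo fun u hu => ?_
  rw [← lintegral_const_mul' _ _ (by simp)]
  refine lintegral_mono fun t => ?_
  dsimp only
  gcongr
  rw [← ENNReal.ofReal_coe_nnreal, ← ENNReal.ofReal_pow B.coe_nonneg, sq]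
  refine ENNReal.ofReal_le_ofReal ?_
  have := hB u (Ioo_subset_Icc_self hu)
  exact mul_le_mul this.1 this.2 (Real.sqrt_nonneg _) B.coe_nonneg

theorem vol_univ_lt_top : F.vol univ < ⊤ := by
  obtain ⟨B, -, hB⟩ := F.exists_bound
  have h := F.lintegral_vol_le (fun u hu => ⟨(hB u hu).1, (hB u hu).2.2.1⟩)
    (measurable_const (a := (1 : ℝ≥0∞)))
  rw [lintegral_one] at h
  refine h.trans_lt (ENNReal.mul_lt_top (by simp) ?_)
  simp only [lintegral_const, one_mul, Measure.restrict_apply MeasurableSet.univ, univ_inter,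
    Real.volume_Ioo]
  exact ENNReal.mul_lt_top (by simp) (by simp)

instance isFiniteMeasure_vol : IsFiniteMeasure F.vol := ⟨F.vol_univ_lt_top⟩

/-- Integrals over the fracture of functions of `u` alone. -/
theorem lintegral_vol_fst_le {B : ℝ≥0} (hB : ∀ u ∈ Icc 0 F.L, F.h u ≤ B ∧ √(F.g₁₁ u) ≤ B)
    {g : ℝ → ℝ≥0∞} (hg : Measurable g) :
    ∫⁻ x, g x.1 ∂F.vol ≤ (B : ℝ≥0∞) ^ 2 * (2 * ∫⁻ u in Ioo 0 F.L, g u) := by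
  refine (F.lintegral_vol_le hB (hg.comp measurable_fst)).trans (le_of_eq ?_)
  rw [← lintegral_const_mul _ hg]
  congr 1
  refine lintegral_congr fun u => ?_
  simp only [Function.comp_apply, lintegral_const, Measure.restrict_apply MeasurableSet.univ,
    univ_inter, Real.volume_Ioo]
  norm_num
  ring

/-- Lets a.e. statements and a.e. measurability of $q^\pm$ on $(0,L)$ be pulled back to the
fracture. -/
theorem quasiMeasurePreserving_fst :
    Measure.QuasiMeasurePreserving Prod.fst F.vol (volume.restrict (Ioo 0 F.L)) := by
  obtain ⟨B, -, hB⟩ := F.exists_bound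
  refine ⟨measurable_fst, Measure.AbsolutelyContinuous.mk fun s hs h0 => ?_⟩
  rw [Measure.map_apply measurable_fst hs]
  have h := F.lintegral_vol_fst_le (fun u hu => ⟨(hB u hu).1, (hB u hu).2.2.1⟩)
    (measurable_one.indicator hs)
  rw [lintegral_indicator_one hs, h0, mul_zero, mul_zero, nonpos_iff_eq_zero] at h
  rw [← h, ← lintegral_indicator_one (measurable_fst hs)]
  rfl

theorem ae_vol_iff_ae_domain {p : ℝ × ℝ → Prop} :
    (∀ᵐ x ∂F.vol, p x) ↔ ∀ᵐ x ∂(volume.restrict F.domain), p x := by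
  have hw : Measurable fun x : ℝ × ℝ => ENNReal.ofReal (√(F.g₁₁ x.1)) := by
    have := F.continuous_g₁₁
    fun_prop
  rw [vol, ae_withDensity_iff hw]
  refine eventually_congr (Eventually.of_forall fun x => ?_)
  have : ENNReal.ofReal (√(F.g₁₁ x.1)) ≠ 0 := by
    simpa using F.g₁₁_pos x.1
  simp [this]

/-- Weak derivatives are defined with Lebesgue measure and norms with $\mu$; the density
$\sqrt{g_{11}}\ge1$ allows passing from the latter to the former. -/
theorem volume_restrict_le_vol : volume.restrict F.domain ≤ F.vol := by
  conv_lhs => rw [← withDensity_one (μ := volume.restrict F.domain)]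
  refine withDensity_mono (ae_of_all _ fun x => ?_)
  simpa using F.one_le_sqrt_g₁₁ x.1

end Fracture

/-! ### Gradients in an orthonormal frame -/

namespace Fracture

variable (F : Fracture)

/-- The gradient of a function with partial derivatives `a = ∂_u φ` and `b = ∂_λ φ`, written in the
`g`-orthonormal frame of the coordinate directions. -/
noncomputable def frameGrad (u a b : ℝ) : ℂ := ⟨a / √(F.g₁₁ u), b⟩

/-- Splitting the weight $g_{11}$ evenly between the two vectors makes the inner product Euclidean.
With $\mathbb C$ as the Euclidean plane, the estimates for `forchheimerFlux` in an inner product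
space apply at each point. -/
theorem inner_frameGrad (u a b a' b' : ℝ) :
    inner ℝ (F.frameGrad u a b) (F.frameGrad u a' b') =
      F.gInner u (F.gGrad u a b) (F.gGrad u a' b') := by
  have h := F.g₁₁_pos u
  have h2 := Real.sq_sqrt h.le
  have h3 : √(F.g₁₁ u) ≠ 0 := (Real.sqrt_pos.2 h).ne'
  rw [Complex.inner]
  simp only [frameGrad, gInner, gGrad, Complex.mul_re, Complex.conj_re, Complex.conj_im]
  field_simp
  rw [h2]
  ring

theorem norm_frameGrad (u a b : ℝ) : ‖F.frameGrad u a b‖ = F.gNorm u (F.gGrad u a b) := by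
  rw [gNorm, ← inner_frameGrad, real_inner_self_eq_norm_sq, Real.sqrt_sq (norm_nonneg _)]

theorem gNorm_gGradU (u a : ℝ) : F.gNorm u (F.gGradU u a) = ‖F.frameGrad u a 0‖ :=
  (F.norm_frameGrad u a 0).symm

theorem frameGrad_sub (u a b a' b' : ℝ) :
    F.frameGrad u (a - a') (b - b') = F.frameGrad u a b - F.frameGrad u a' b' := by
  apply Complex.ext <;> simp [frameGrad, sub_div]

theorem abs_snd_le_norm_frameGrad (u a b : ℝ) : |b| ≤ ‖F.frameGrad u a b‖ :=
  Complex.abs_im_le_norm (F.frameGrad u a b)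

theorem abs_fst_le_norm_frameGrad (u a b : ℝ) : |a| ≤ √(F.g₁₁ u) * ‖F.frameGrad u a b‖ := by
  have h : |a / √(F.g₁₁ u)| ≤ ‖F.frameGrad u a b‖ :=
    Complex.abs_re_le_norm (F.frameGrad u a b)
  have h3 : 0 < √(F.g₁₁ u) := Real.sqrt_pos.2 (F.g₁₁_pos u)
  rwa [abs_div, abs_of_pos h3, div_le_iff₀' h3] at h

theorem norm_frameGrad_zero_le (u a b : ℝ) : ‖F.frameGrad u a 0‖ ≤ ‖F.frameGrad u a b‖ := by
  have h : |a / √(F.g₁₁ u)| ≤ ‖F.frameGrad u a b‖ :=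
    Complex.abs_re_le_norm (F.frameGrad u a b)
  have e : F.frameGrad u a 0 = ((a / √(F.g₁₁ u) : ℝ) : ℂ) := by
    apply Complex.ext <;> simp [frameGrad]
  rwa [e, Complex.norm_real]

theorem norm_frameGrad_le (u a b : ℝ) : ‖F.frameGrad u a b‖ ≤ |a| + |b| := by
  refine (Complex.norm_le_abs_re_add_abs_im _).trans (add_le_add ?_ le_rfl)
  simp only [frameGrad, abs_div, abs_of_nonneg (Real.sqrt_nonneg _)]
  exact div_le_self (abs_nonneg a) (F.one_le_sqrt_g₁₁ u)

theorem aestronglyMeasurable_frameGrad {a b : ℝ × ℝ → ℝ} {μ : Measure (ℝ × ℝ)}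
    (ha : AEStronglyMeasurable a μ) (hb : AEStronglyMeasurable b μ) :
    AEStronglyMeasurable (fun x => F.frameGrad x.1 (a x) (b x)) μ := by
  have hG : Measurable fun x : ℝ × ℝ => √(F.g₁₁ x.1) := by
    have := F.continuous_g₁₁
    fun_prop
  exact (Complex.measurableEquivRealProd.symm.measurable.comp_aemeasurable
    ((ha.aemeasurable.div hG.aemeasurable).prodMk hb.aemeasurable)).aestronglyMeasurable

theorem eLpNorm_frameGrad_le {a b : ℝ × ℝ → ℝ} (ha : AEStronglyMeasurable a F.vol)
    (hb : AEStronglyMeasurable b F.vol) :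
    eLpNorm (fun x => F.frameGrad x.1 (a x) (b x)) (3 / 2) F.vol ≤
      eLpNorm a (3 / 2) F.vol + eLpNorm b (3 / 2) F.vol := by
  have h : eLpNorm (fun x => F.frameGrad x.1 (a x) (b x)) (3 / 2) F.vol ≤
      eLpNorm ((fun x => ‖a x‖) + fun x => ‖b x‖) (3 / 2) F.vol := by
    refine eLpNorm_mono_real fun x => ?_
    exact F.norm_frameGrad_le x.1 (a x) (b x)
  refine h.trans ((eLpNorm_add_le ha.norm hb.norm ENNReal.one_le_three_div_two).trans ?_)
  rw [eLpNorm_norm, eLpNorm_norm]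

theorem memLp_frameGrad {a b : ℝ × ℝ → ℝ} (ha : MemLp a (3 / 2) F.vol)
    (hb : MemLp b (3 / 2) F.vol) :
    MemLp (fun x => F.frameGrad x.1 (a x) (b x)) (3 / 2) F.vol :=
  ⟨F.aestronglyMeasurable_frameGrad ha.1 hb.1,
    (F.eLpNorm_frameGrad_le ha.1 hb.1).trans_lt (ENNReal.add_lt_top.2 ⟨ha.2, hb.2⟩)⟩

/-- The gradient of a smooth function, in the orthonormal frame. -/
noncomputable def grad (φ : ℝ × ℝ → ℝ) (x : ℝ × ℝ) : ℂ :=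
  F.frameGrad x.1 (partialU φ x) (partialL φ x)

theorem continuous_partialU {φ : ℝ × ℝ → ℝ} (hφ : ContDiff ℝ ∞ φ) : Continuous (partialU φ) :=
  (hφ.continuous_fderiv (by simp)).clm_apply continuous_const

theorem continuous_partialL {φ : ℝ × ℝ → ℝ} (hφ : ContDiff ℝ ∞ φ) : Continuous (partialL φ) :=
  (hφ.continuous_fderiv (by simp)).clm_apply continuous_const

theorem continuous_grad {φ : ℝ × ℝ → ℝ} (hφ : ContDiff ℝ ∞ φ) : Continuous (F.grad φ) := by
  have h1 := continuous_partialU hφ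
  have h2 := continuous_partialL hφ
  have h3 := F.continuous_g₁₁
  have : F.grad φ = fun x => ((partialU φ x / √(F.g₁₁ x.1) : ℝ) : ℂ)
      + ((partialL φ x : ℝ) : ℂ) * Complex.I := by
    ext x
    apply Complex.ext <;> simp [grad, frameGrad]
  rw [this]
  refine (Complex.continuous_ofReal.comp (h1.div (by fun_prop) fun x => ?_)).add
    ((Complex.continuous_ofReal.comp h2).mul continuous_const)
  exact (Real.sqrt_pos.2 (F.g₁₁_pos _)).ne'

theorem hasDerivAt_comp_prodMk {φ : ℝ × ℝ → ℝ} (hφ : ContDiff ℝ ∞ φ) {p q : ℝ → ℝ} {p' q' s : ℝ}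
    (hp : HasDerivAt p p' s) (hq : HasDerivAt q q' s) :
    HasDerivAt (fun s => φ (p s, q s))
      (p' * partialU φ (p s, q s) + q' * partialL φ (p s, q s)) s := by
  have h := ((hφ.differentiable (by simp)) (p s, q s)).hasFDerivAt.comp_hasDerivAt s
    (hp.prodMk hq)
  have e : ((p', q') : ℝ × ℝ) = p' • (1, 0) + q' • (0, 1) := by simp
  rw [e, map_add, map_smul, map_smul] at h
  exact h

/-! ### Poincaré and trace inequality -/

theorem enorm_sub_le_lintegral_of_hasDerivAt {θ θ' : ℝ → ℝ} (h : ∀ s, HasDerivAt θ (θ' s) s)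
    (hc : Continuous θ') (a b : ℝ) : ‖θ b - θ a‖ₑ ≤ ∫⁻ s in uIoc a b, ‖θ' s‖ₑ := by
  rw [← intervalIntegral.integral_eq_sub_of_hasDerivAt (fun s _ => h s)
    (hc.intervalIntegrable a b)]
  have := intervalIntegral.norm_intervalIntegral_eq θ' a b volume
  rw [← enorm_norm, this, enorm_norm]
  exact enorm_integral_le_lintegral_enorm _

/-- Hölder against the constant $1$ with exponents $\tfrac32$ and $3$. -/
theorem lintegral_rpow_le {X : Type*} [MeasurableSpace X] (ν : Measure X) {g : X → ℝ≥0∞}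
    (hg : AEMeasurable g ν) :
    (∫⁻ x, g x ∂ν) ^ (3 / 2 : ℝ) ≤ ν univ ^ (1 / 2 : ℝ) * ∫⁻ x, g x ^ (3 / 2 : ℝ) ∂ν := by
  have hpq : Real.HolderConjugate (3 / 2) 3 := by
    rw [Real.holderConjugate_iff]
    norm_num
  have h := ENNReal.lintegral_mul_le_Lp_mul_Lq ν hpq hg (aemeasurable_const (b := 1))
  simp only [Pi.mul_apply, mul_one, ENNReal.one_rpow, lintegral_one] at h
  calc _ ≤ ((∫⁻ x, g x ^ (3 / 2 : ℝ) ∂ν) ^ (1 / (3 / 2) : ℝ) * ν univ ^ (1 / 3 : ℝ)) ^ (3 / 2 : ℝ) :=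
        ENNReal.rpow_le_rpow h (by norm_num)
    _ = _ := by
        rw [ENNReal.mul_rpow_of_nonneg _ _ (by norm_num), ← ENNReal.rpow_mul, ← ENNReal.rpow_mul,
          mul_comm]
        norm_num

/-- Follow the curve $\lambda=t\,h(s)$ from the well, where $\varphi=0$, up to $s=u$, then move
vertically from $t$ to $t_0$. The parameter $t$ is free: averaging over it later turns the integral
along the curve into one over the fracture. The values $t_0=\pm1$ give traces on the edges. -/
theorem enorm_test_le {B : ℝ≥0} (hB : ∀ u ∈ Icc 0 F.L, F.h u ≤ B ∧ |deriv F.h u| ≤ B ∧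
    √(F.g₁₁ u) ≤ B) {φ : ℝ × ℝ → ℝ} (hφ : F.IsTest φ) {t₀ : ℝ} (ht₀ : t₀ ∈ Icc (-1) 1)
    {u t : ℝ} (hu : u ∈ Ioo 0 F.L) (ht : t ∈ Ioo (-1) 1) :
    ‖φ (u, t₀ * F.h u)‖ₑ ≤ (2 * B : ℝ≥0) *
      ((∫⁻ s in Ioo 0 F.L, ‖F.grad φ (s, t * F.h s)‖ₑ)
        + ∫⁻ τ in Ioo (-1) 1, ‖F.grad φ (u, τ * F.h u)‖ₑ) := by
  have hch := F.continuous_h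
  have hcd := F.continuous_deriv_h
  have hcU := continuous_partialU hφ.1
  have hcL := continuous_partialL hφ.1
  have h0 : φ (0, t * F.h 0) = 0 := by
    have := F.h_pos 0 ⟨le_rfl, F.L_pos.le⟩
    refine hφ.2 _ ⟨rfl, ?_, ?_⟩ <;> simp only <;> nlinarith [ht.1, ht.2]
  have h1 : ‖φ (u, t * F.h u)‖ₑ ≤ (2 * B : ℝ≥0) *
      ∫⁻ s in Ioo 0 F.L, ‖F.grad φ (s, t * F.h s)‖ₑ := by
    have h := enorm_sub_le_lintegral_of_hasDerivAt (θ := fun s => φ (s, t * F.h s))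
      (fun s => hasDerivAt_comp_prodMk hφ.1 (hasDerivAt_id s) ((F.hasDerivAt_h s).const_mul t))
      (by fun_prop) 0 u
    rw [h0, sub_zero, uIoc_of_le hu.1.le] at h
    refine h.trans ?_
    rw [← lintegral_const_mul' _ _ ENNReal.coe_ne_top]
    refine (lintegral_mono_set (Ioc_subset_Ioo_right hu.2)).trans
      (setLIntegral_mono' measurableSet_Ioo fun s hs => ?_)
    rw [← ofReal_norm, ← ofReal_norm, ← ENNReal.ofReal_coe_nnreal,
      ← ENNReal.ofReal_mul (NNReal.coe_nonneg _)]
    refine ENNReal.ofReal_le_ofReal ?_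
    obtain ⟨-, b2, b3⟩ := hB s (Ioo_subset_Icc_self hs)
    have c1 : |partialU φ (s, t * F.h s)| ≤ B * ‖F.grad φ (s, t * F.h s)‖ :=
      (F.abs_fst_le_norm_frameGrad _ _ _).trans (by gcongr; exact le_rfl)
    have c2 : |partialL φ (s, t * F.h s)| ≤ ‖F.grad φ (s, t * F.h s)‖ :=
      F.abs_snd_le_norm_frameGrad _ _ _
    have c3 : |t| ≤ 1 := abs_le.2 ⟨ht.1.le, ht.2.le⟩
    have c4 : |t * deriv F.h s * partialL φ (s, t * F.h s)| ≤
        -- One $B$ comes from $\sqrt{g_{11}}$ in the $u$-derivative, the other from the slope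
        -- $t\,h'$ of the curve; hence $2B$.
        1 * B * ‖F.grad φ (s, t * F.h s)‖ := by
      rw [abs_mul, abs_mul]
      gcongr
    simp only [one_mul, Real.norm_eq_abs]
    refine (abs_add_le _ _).trans ?_
    push_cast
    linarith
  have h2 : ‖φ (u, t₀ * F.h u) - φ (u, t * F.h u)‖ₑ ≤ (2 * B : ℝ≥0) *
      ∫⁻ τ in Ioo (-1) 1, ‖F.grad φ (u, τ * F.h u)‖ₑ := by
    have h := enorm_sub_le_lintegral_of_hasDerivAt (θ := fun τ => φ (u, τ * F.h u))
      (fun s => hasDerivAt_comp_prodMk hφ.1 (hasDerivAt_const s u)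
        ((hasDerivAt_id s).mul_const (F.h u)))
      (by fun_prop) t t₀
    refine h.trans ?_
    rw [← lintegral_const_mul' _ _ ENNReal.coe_ne_top, setLIntegral_congr Ioo_ae_eq_Ioc]
    have hsub : uIoc t t₀ ⊆ Ioc (-1) 1 := Ioc_subset_Ioc (le_min ht.1.le ht₀.1)
      (max_le ht.2.le ht₀.2)
    refine (lintegral_mono_set hsub).trans (lintegral_mono fun s => ?_)
    rw [← ofReal_norm, ← ofReal_norm, ← ENNReal.ofReal_coe_nnreal,
      ← ENNReal.ofReal_mul (NNReal.coe_nonneg _)]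
    refine ENNReal.ofReal_le_ofReal ?_
    have b1 := (hB u (Ioo_subset_Icc_self hu)).1
    have b0 := F.h_pos u (Ioo_subset_Icc_self hu)
    have c2 : |partialL φ (u, s * F.h u)| ≤ ‖F.grad φ (u, s * F.h u)‖ :=
      F.abs_snd_le_norm_frameGrad _ _ _
    have c4 : |F.h u * partialL φ (u, s * F.h u)| ≤ B * ‖F.grad φ (u, s * F.h u)‖ := by
      rw [abs_mul, abs_of_pos b0]
      gcongr
    have c5 : 0 ≤ B * ‖F.grad φ (u, s * F.h u)‖ := by positivity
    simp only [one_mul, zero_mul, zero_add, Real.norm_eq_abs]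
    push_cast
    linarith
  calc ‖φ (u, t₀ * F.h u)‖ₑ
      = ‖φ (u, t * F.h u) + (φ (u, t₀ * F.h u) - φ (u, t * F.h u))‖ₑ := by rw [add_sub_cancel]
    _ ≤ ‖φ (u, t * F.h u)‖ₑ + ‖φ (u, t₀ * F.h u) - φ (u, t * F.h u)‖ₑ := enorm_add_le _ _
    _ ≤ _ := by
        rw [mul_add]
        exact add_le_add h1 h2

/-- Smooth functions vanishing on the well are controlled by their gradient in `L^{3/2}` along every
curve `λ = t₀ h(u)`. -/
theorem exists_lintegral_curve_le : ∃ C : ℝ≥0, ∀ φ, F.IsTest φ → ∀ t₀ ∈ Icc (-1 : ℝ) 1,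
    ∫⁻ u in Ioo 0 F.L, ‖φ (u, t₀ * F.h u)‖ₑ ^ (3 / 2 : ℝ) ≤
      C * ∫⁻ x, ‖F.grad φ x‖ₑ ^ (3 / 2 : ℝ) ∂F.vol := by
  obtain ⟨c, hc, hcF⟩ := F.exists_le_h
  obtain ⟨B, -, hB⟩ := F.exists_bound
  have hB' : ∀ u ∈ Icc 0 F.L, F.h u ≤ B ∧ |deriv F.h u| ≤ B ∧ √(F.g₁₁ u) ≤ B := fun u hu =>
    ⟨(hB u hu).1, (hB u hu).2.1, (hB u hu).2.2.1⟩
  -- The number $m=L+2$ bounds the lengths of both $(0,L)$ and $(-1,1)$, and is also the factor left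
  -- after integrating in $u$. In $C_1$, the power of $2$ comes from convexity of $x^{3/2}$ and
  -- $m^{1/2}$ from `lintegral_rpow_le`.
  set m : ℝ≥0∞ := ENNReal.ofReal F.L + 2 with hm
  set C₁ : ℝ≥0∞ := ((2 * B : ℝ≥0) : ℝ≥0∞) ^ (3 / 2 : ℝ) *
    ((2 : ℝ≥0∞) ^ (3 / 2 - 1 : ℝ) * m ^ (1 / 2 : ℝ)) with hC₁
  have hmt : m ≠ ⊤ := by simp [hm]
  have hC₁t : C₁ ≠ ⊤ := by
    refine ENNReal.mul_ne_top (ENNReal.rpow_ne_top_of_nonneg (by norm_num) ENNReal.coe_ne_top)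
      (ENNReal.mul_ne_top (ENNReal.rpow_ne_top_of_nonneg (by norm_num) (by simp))
        (ENNReal.rpow_ne_top_of_nonneg (by norm_num) hmt))
  have hC : C₁ * m * (c : ℝ≥0∞)⁻¹ ≠ ⊤ :=
    ENNReal.mul_ne_top (ENNReal.mul_ne_top hC₁t hmt) (by simpa using hc.ne')
  refine ⟨(C₁ * m * (c : ℝ≥0∞)⁻¹).toNNReal, fun φ hφ t₀ ht₀ => ?_⟩
  rw [ENNReal.coe_toNNReal hC]
  have hgm : Measurable fun x => ‖F.grad φ x‖ₑ := (F.continuous_grad hφ.1).measurable.enorm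
  set G : ℝ → ℝ → ℝ≥0∞ := fun u t => ‖F.grad φ (u, t * F.h u)‖ₑ with hG
  have hGm : Measurable fun y : ℝ × ℝ => G y.1 y.2 := F.measurable_scaled hgm
  have hGm' : Measurable fun y : ℝ × ℝ => G y.1 y.2 ^ (3 / 2 : ℝ) := hGm.pow_const _
  have hvI : volume.restrict (Ioo (-1 : ℝ) 1) univ = 2 := by
    rw [Measure.restrict_apply_univ, Real.volume_Ioo]
    norm_num
  have hvL : volume.restrict (Ioo 0 F.L) univ = ENNReal.ofReal F.L := by
    rw [Measure.restrict_apply_univ, Real.volume_Ioo, sub_zero]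
  set S := ∫⁻ u in Ioo 0 F.L, ∫⁻ t in Ioo (-1) 1, G u t ^ (3 / 2 : ℝ) with hS
  have hpt : ∀ u ∈ Ioo 0 F.L, ∀ t ∈ Ioo (-1 : ℝ) 1, ‖φ (u, t₀ * F.h u)‖ₑ ^ (3 / 2 : ℝ) ≤
      C₁ * ((∫⁻ s in Ioo 0 F.L, G s t ^ (3 / 2 : ℝ)) + ∫⁻ τ in Ioo (-1) 1, G u τ ^ (3 / 2 : ℝ)) := by
    intro u hu t ht
    refine (ENNReal.rpow_le_rpow (F.enorm_test_le hB' hφ ht₀ hu ht) (by norm_num)).trans ?_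
    rw [ENNReal.mul_rpow_of_nonneg _ _ (by norm_num), hC₁, mul_assoc, mul_assoc]
    gcongr
    refine (ENNReal.rpow_add_le_mul_rpow_add_rpow _ _ (by norm_num)).trans ?_
    gcongr
    rw [mul_add]
    gcongr
    · refine (lintegral_rpow_le _
        (hGm.comp measurable_prodMk_right).aemeasurable).trans ?_
      simp only [Function.comp_apply]
      rw [hvL]
      gcongr
      exact le_self_add
    · refine (lintegral_rpow_le _
        (hGm.comp measurable_prodMk_left).aemeasurable).trans ?_
      simp only [Function.comp_apply]
      rw [hvI]
      gcongr
      exact le_add_self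
  have hswap : ∫⁻ t in Ioo (-1) 1, ∫⁻ s in Ioo 0 F.L, G s t ^ (3 / 2 : ℝ) = S :=
    (lintegral_lintegral_swap hGm'.aemeasurable).symm
  -- Integrate the pointwise bound over $t\in(-1,1)$. The left side does not depend on $t$ and only
  -- gains a factor $2\ge1$.
  have hu' : ∀ u ∈ Ioo 0 F.L, ‖φ (u, t₀ * F.h u)‖ₑ ^ (3 / 2 : ℝ) ≤
      C₁ * (S + 2 * ∫⁻ τ in Ioo (-1) 1, G u τ ^ (3 / 2 : ℝ)) := by
    intro u hu
    have h := setLIntegral_mono' (μ := volume) measurableSet_Ioo (hpt u hu)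
    rw [lintegral_const, hvI, lintegral_const_mul' _ _ hC₁t,
      lintegral_add_right _ measurable_const, hswap, lintegral_const, hvI, mul_comm _ 2,
      mul_comm _ 2] at h
    exact le_trans (le_mul_of_one_le_left' (by norm_num)) h
  calc _ ≤ ∫⁻ u in Ioo 0 F.L, C₁ * (S + 2 * ∫⁻ τ in Ioo (-1) 1, G u τ ^ (3 / 2 : ℝ)) :=
        setLIntegral_mono' measurableSet_Ioo hu'
    _ = C₁ * m * S := by
        rw [lintegral_const_mul' _ _ hC₁t, lintegral_add_left measurable_const, lintegral_const,
          hvL, lintegral_const_mul' _ _ (by simp), hm, mul_assoc C₁, add_mul, mul_comm S]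
    _ ≤ C₁ * m * ((c : ℝ≥0∞)⁻¹ * ∫⁻ x, ‖F.grad φ x‖ₑ ^ (3 / 2 : ℝ) ∂F.vol) := by
        gcongr
        exact F.lintegral_scaled_le hc hcF (hgm.pow_const _)
    _ = _ := by rw [← mul_assoc]

end Fracture

namespace Fracture

variable (F : Fracture)

/-! ### Bounds for the load functionals -/

theorem eLpNorm_le_of_lintegral_rpow_le {X Y E E' : Type*} [MeasurableSpace X] [MeasurableSpace Y]
    [NormedAddCommGroup E] [NormedAddCommGroup E'] {μ : Measure X} {ν : Measure Y} {p : ℝ≥0∞}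
    (hp : p ≠ 0) (hp' : p ≠ ⊤) {f : X → E} {g : Y → E'} {C : ℝ≥0∞}
    (h : ∫⁻ x, ‖f x‖ₑ ^ p.toReal ∂μ ≤ C * ∫⁻ y, ‖g y‖ₑ ^ p.toReal ∂ν) :
    eLpNorm f p μ ≤ C ^ (1 / p.toReal) * eLpNorm g p ν := by
  rw [eLpNorm_eq_lintegral_rpow_enorm_toReal hp hp', eLpNorm_eq_lintegral_rpow_enorm_toReal hp hp',
    ← ENNReal.mul_rpow_of_nonneg _ _ (by positivity)]
  exact ENNReal.rpow_le_rpow h (by positivity)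

theorem exists_eLpNorm_curve_le : ∃ C : ℝ≥0, ∀ φ, F.IsTest φ → ∀ t₀ ∈ Icc (-1 : ℝ) 1,
    eLpNorm (fun u => φ (u, t₀ * F.h u)) (3 / 2) (volume.restrict (Ioo 0 F.L)) ≤
      C * eLpNorm (F.grad φ) (3 / 2) F.vol := by
  obtain ⟨C, hC⟩ := F.exists_lintegral_curve_le
  refine ⟨C ^ (1 / (3 / 2) : ℝ), fun φ hφ t₀ ht₀ => ?_⟩
  rw [ENNReal.coe_rpow_of_nonneg _ (by norm_num), ← ENNReal.toReal_three_div_two]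
  refine eLpNorm_le_of_lintegral_rpow_le ENNReal.three_div_two_ne_zero
    ENNReal.three_div_two_ne_top ?_
  rw [ENNReal.toReal_three_div_two]
  exact hC φ hφ t₀ ht₀

/-- The Poincaré inequality: integrate the estimate on the curves $\lambda=t_0h(u)$ over
$t_0\in(-1,1)$. -/
theorem exists_eLpNorm_test_le : ∃ C : ℝ≥0, ∀ φ, F.IsTest φ →
    eLpNorm φ (3 / 2) F.vol ≤ C * eLpNorm (F.grad φ) (3 / 2) F.vol := by
  obtain ⟨C, hC⟩ := F.exists_lintegral_curve_le
  obtain ⟨B, -, hB⟩ := F.exists_bound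
  refine ⟨(B ^ 2 * (C * 2)) ^ (1 / (3 / 2) : ℝ), fun φ hφ => ?_⟩
  rw [ENNReal.coe_rpow_of_nonneg _ (by norm_num), ← ENNReal.toReal_three_div_two]
  refine eLpNorm_le_of_lintegral_rpow_le ENNReal.three_div_two_ne_zero
    ENNReal.three_div_two_ne_top ?_
  rw [ENNReal.toReal_three_div_two]
  have hm : Measurable fun x => ‖φ x‖ₑ ^ (3 / 2 : ℝ) :=
    hφ.1.continuous.measurable.enorm.pow_const _
  refine (F.lintegral_vol_le (fun u hu => ⟨(hB u hu).1, (hB u hu).2.2.1⟩) hm).trans ?_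
  rw [lintegral_lintegral_swap (F.measurable_scaled hm).aemeasurable]
  have h := setLIntegral_mono' (μ := volume) measurableSet_Ioo
    (fun t (ht : t ∈ Ioo (-1 : ℝ) 1) => hC φ hφ t (Ioo_subset_Icc_self ht))
  rw [lintegral_const, Measure.restrict_apply_univ, Real.volume_Ioo] at h
  calc _ ≤ (B : ℝ≥0∞) ^ 2 * (C * (∫⁻ x, ‖F.grad φ x‖ₑ ^ (3 / 2 : ℝ) ∂F.vol)
        * ENNReal.ofReal (1 - -1)) := by gcongr
    _ = _ := by
        norm_num
        ring

theorem exists_eLpNorm_fst_le : ∃ C : ℝ≥0, ∀ q : ℝ → ℝ,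
    AEStronglyMeasurable q (volume.restrict (Ioo 0 F.L)) →
    eLpNorm q 3 (volume.restrict (Ioo 0 F.L)) ≤ C * eLpNorm (fun x : ℝ × ℝ => q x.1) 3 F.vol := by
  obtain ⟨c, hc, hcF⟩ := F.exists_le_h
  refine ⟨c⁻¹ ^ (1 / 3 : ℝ), fun q hq => ?_⟩
  -- The change of variables needs a measurable integrand, so $q$ is replaced by a measurable
  -- representative on both sides.
  have h1 : eLpNorm q 3 (volume.restrict (Ioo 0 F.L)) =
      eLpNorm (hq.mk q) 3 (volume.restrict (Ioo 0 F.L)) := eLpNorm_congr_ae hq.ae_eq_mk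
  have h2 : eLpNorm (fun x : ℝ × ℝ => q x.1) 3 F.vol =
      eLpNorm (fun x : ℝ × ℝ => hq.mk q x.1) 3 F.vol :=
    eLpNorm_congr_ae (F.quasiMeasurePreserving_fst.ae_eq_comp hq.ae_eq_mk)
  rw [h1, h2, ENNReal.coe_rpow_of_nonneg _ (by norm_num), ← ENNReal.toReal_ofNat 3]
  refine eLpNorm_le_of_lintegral_rpow_le (by simp) (by simp) ?_
  have hm : Measurable fun x : ℝ × ℝ => ‖hq.mk q x.1‖ₑ ^ (3 : ℝ≥0∞).toReal :=
    (hq.stronglyMeasurable_mk.measurable.comp measurable_fst).enorm.pow_const _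
  rw [ENNReal.coe_inv hc.ne']
  refine le_trans (lintegral_mono fun u => ?_) (F.lintegral_scaled_le hc hcF hm)
  dsimp only
  rw [lintegral_const, Measure.restrict_apply_univ, Real.volume_Ioo]
  refine le_mul_of_one_le_right' ?_
  norm_num

theorem gNorm_tangent (u s : ℝ) (hs : s ^ 2 = 1) :
    F.gNorm u (1, s * deriv F.h u) = F.gNorm u (1, deriv F.h u) := by
  simp only [gNorm, gInner]
  congr 2
  linear_combination deriv F.h u ^ 2 * hs

/-- Hölder on $(0,L)$ combined with the trace estimate at $t_0=s=\pm1$. -/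
theorem exists_enorm_edgeIntegral_le : ∃ C : ℝ≥0, ∀ q : ℝ → ℝ,
    AEStronglyMeasurable q (volume.restrict (Ioo 0 F.L)) → ∀ s : ℝ, s ^ 2 = 1 →
    ∀ φ, F.IsTest φ → ‖F.edgeIntegral s (fun x => q x.1 * φ x)‖ₑ ≤
      C * eLpNorm (fun x : ℝ × ℝ => q x.1) 3 F.vol * eLpNorm (F.grad φ) (3 / 2) F.vol := by
  obtain ⟨B, -, hB⟩ := F.exists_bound
  obtain ⟨C₁, hC₁⟩ := F.exists_eLpNorm_curve_le
  obtain ⟨C₂, hC₂⟩ := F.exists_eLpNorm_fst_le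
  refine ⟨B * C₁ * C₂, fun q hq s hs φ hφ => ?_⟩
  have hsI : s ∈ Icc (-1 : ℝ) 1 := abs_le.1 ((sq_le_one_iff_abs_le_one s).1 hs.le)
  have hφm : AEStronglyMeasurable (fun u => φ (u, s * F.h u)) (volume.restrict (Ioo 0 F.L)) := by
    have h1 := hφ.1.continuous
    have h2 := F.continuous_h
    exact (by fun_prop : Continuous fun u => φ (u, s * F.h u)).aestronglyMeasurable
  rw [edgeIntegral, intervalIntegral.integral_of_le F.L_pos.le, integral_Ioc_eq_integral_Ioo]
  calc _ ≤ ∫⁻ u in Ioo 0 F.L, ‖q u * φ (u, s * F.h u) * F.gNorm u (1, s * deriv F.h u)‖ₑ :=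
        enorm_integral_le_lintegral_enorm _
    _ ≤ ∫⁻ u in Ioo 0 F.L, B * (‖q u‖ₑ * ‖φ (u, s * F.h u)‖ₑ) := by
        refine setLIntegral_mono' measurableSet_Ioo fun u hu => ?_
        rw [enorm_mul, enorm_mul, mul_comm, F.gNorm_tangent u s hs,
          Real.enorm_of_nonneg (show 0 ≤ F.gNorm u (1, deriv F.h u) from Real.sqrt_nonneg _)]
        gcongr
        rw [← ENNReal.ofReal_coe_nnreal]
        exact ENNReal.ofReal_le_ofReal (hB u (Ioo_subset_Icc_self hu)).2.2.2
    _ ≤ B * ((C₂ * eLpNorm (fun x : ℝ × ℝ => q x.1) 3 F.vol) *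
          (C₁ * eLpNorm (F.grad φ) (3 / 2) F.vol)) := by
        rw [lintegral_const_mul' _ _ (by simp)]
        gcongr
        refine (lintegral_enorm_mul_le hq hφm).trans ?_
        gcongr
        · exact hC₂ q hq
        · exact hC₁ φ hφ s hsI
    _ = _ := by
        push_cast
        ring

theorem exists_lintegral_source_le : ∃ C : ℝ≥0, ∀ q : ℝ → ℝ,
    AEStronglyMeasurable q (volume.restrict (Ioo 0 F.L)) →
    ∀ φ, F.IsTest φ → ∫⁻ x, ‖q x.1 / (2 * F.h x.1) * φ x‖ₑ ∂F.vol ≤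
      C * eLpNorm (fun x : ℝ × ℝ => q x.1) 3 F.vol * eLpNorm (F.grad φ) (3 / 2) F.vol := by
  obtain ⟨c, hc, hcF⟩ := F.exists_le_h
  obtain ⟨C₁, hC₁⟩ := F.exists_eLpNorm_test_le
  refine ⟨c⁻¹ * C₁, fun q hq φ hφ => ?_⟩
  calc _ ≤ ∫⁻ x, (c⁻¹ : ℝ≥0) * (‖q x.1‖ₑ * ‖φ x‖ₑ) ∂F.vol := by
        refine lintegral_mono_ae (F.ae_vol_iff_ae_domain.2 ?_)
        filter_upwards [ae_restrict_mem F.measurableSet_domain] with x hx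
        have h := hcF x.1 ⟨hx.1.le, hx.2.1.le⟩
        have hc' : (0 : ℝ) < c := hc
        rw [enorm_mul, div_eq_mul_inv, enorm_mul, mul_comm ‖q x.1‖ₑ, mul_assoc]
        gcongr
        rw [Real.enorm_of_nonneg (by rw [inv_nonneg]; linarith), ← ENNReal.ofReal_coe_nnreal]
        refine ENNReal.ofReal_le_ofReal ?_
        rw [NNReal.coe_inv]
        exact inv_anti₀ hc' (by linarith)
    _ ≤ (c⁻¹ : ℝ≥0) * (eLpNorm (fun x : ℝ × ℝ => q x.1) 3 F.vol *
          (C₁ * eLpNorm (F.grad φ) (3 / 2) F.vol)) := by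
        rw [lintegral_const_mul' _ _ ENNReal.coe_ne_top]
        gcongr
        refine (lintegral_enorm_mul_le (hq.comp_quasiMeasurePreserving
          F.quasiMeasurePreserving_fst) hφ.1.continuous.aestronglyMeasurable).trans ?_
        gcongr
        exacts [le_rfl, hC₁ φ hφ]
    _ = _ := by
        rw [ENNReal.coe_mul]
        ring

theorem exists_lintegral_test_le : ∃ C : ℝ≥0, ∀ k : ℝ, ∀ φ, F.IsTest φ →
    ∫⁻ x, ‖k * φ x‖ₑ ∂F.vol ≤ C * ‖k‖ₑ * eLpNorm (F.grad φ) (3 / 2) F.vol := by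
  obtain ⟨C₁, hC₁⟩ := F.exists_eLpNorm_test_le
  have ht : F.vol univ ^ (1 / 3 : ℝ) ≠ ⊤ :=
    ENNReal.rpow_ne_top_of_nonneg (by norm_num) F.vol_univ_lt_top.ne
  refine ⟨(F.vol univ ^ (1 / 3 : ℝ)).toNNReal * C₁, fun k φ hφ => ?_⟩
  simp_rw [enorm_mul]
  refine (lintegral_enorm_mul_le (P := fun _ => k) aestronglyMeasurable_const
    hφ.1.continuous.aestronglyMeasurable).trans ?_
  rw [eLpNorm_const' _ (by simp) (by simp), ENNReal.coe_mul, ENNReal.coe_toNNReal ht,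
    ENNReal.toReal_ofNat]
  calc _ ≤ ‖k‖ₑ * F.vol univ ^ (1 / 3 : ℝ) * (C₁ * eLpNorm (F.grad φ) (3 / 2) F.vol) := by
        gcongr
        exact hC₁ φ hφ
    _ = _ := by ring

theorem memLp_of_continuous {E : Type*} [NormedAddCommGroup E] {g : ℝ × ℝ → E} (hg : Continuous g)
    (p : ℝ≥0∞) (hm : AEStronglyMeasurable g F.vol) : MemLp g p F.vol := by
  obtain ⟨B, -, hB⟩ := F.exists_bound
  obtain ⟨K, hK⟩ := (isCompact_Icc.prod isCompact_Icc : IsCompact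
    (Icc 0 F.L ×ˢ Icc (-(B : ℝ)) B)).exists_bound_of_continuousOn hg.continuousOn
  refine MemLp.of_bound hm K (F.ae_vol_iff_ae_domain.2 ?_)
  filter_upwards [ae_restrict_mem F.measurableSet_domain] with x hx
  have h := (hB x.1 ⟨hx.1.le, hx.2.1.le⟩).1
  exact hK x ⟨⟨hx.1.le, hx.2.1.le⟩, by linarith [hx.2.2.1], by linarith [hx.2.2.2]⟩

theorem memLp_grad {φ : ℝ × ℝ → ℝ} (hφ : F.IsTest φ) : MemLp (F.grad φ) (3 / 2) F.vol :=
  F.memLp_of_continuous (F.continuous_grad hφ.1) _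
    (F.continuous_grad hφ.1).measurable.aestronglyMeasurable

end Fracture

namespace Fracture

variable (F : Fracture)

/-! ### Weak formulation in the orthonormal frame -/

theorem energyForm_eq_integral_inner (α β : ℝ) (Wu Wl φ : ℝ × ℝ → ℝ) :
    F.energyForm α β Wu Wl φ = ∫ x, inner ℝ (forchheimerFlux α β (F.frameGrad x.1 (Wu x) (Wl x)))
      (F.grad φ x) ∂F.vol := by
  unfold energyForm
  refine integral_congr_ae (ae_of_all _ fun x => ?_)
  simp only [forchheimerFlux, grad, real_inner_smul_left, inner_frameGrad, norm_frameGrad]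

theorem IsTest.sub {F : Fracture} {φ ψ : ℝ × ℝ → ℝ} (hφ : F.IsTest φ) (hψ : F.IsTest ψ) :
    F.IsTest (φ - ψ) :=
  ⟨hφ.1.sub hψ.1, fun x hx => by simp [hφ.2 x hx, hψ.2 x hx]⟩

theorem grad_sub {φ ψ : ℝ × ℝ → ℝ} (hφ : F.IsTest φ) (hψ : F.IsTest ψ) :
    F.grad (φ - ψ) = F.grad φ - F.grad ψ := by
  ext x
  simp only [grad, Pi.sub_apply, ← frameGrad_sub, partialU, partialL,
    fderiv_sub ((hφ.1.differentiable (by simp)) x) ((hψ.1.differentiable (by simp)) x),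
    sub_apply]

theorem IsSobolev.exists_tendsto {F : Fracture} {W Wu Wl : ℝ × ℝ → ℝ} (hW : F.IsSobolev W Wu Wl) :
    ∃ φ : ℕ → ℝ × ℝ → ℝ, (∀ n, F.IsTest (φ n)) ∧
      Tendsto (fun n => eLpNorm (F.grad (φ n) - fun x => F.frameGrad x.1 (Wu x) (Wl x)) (3 / 2)
        F.vol) atTop (𝓝 0) := by
  obtain ⟨φ, hφ, -, h1, h2⟩ := hW.zero_on_well
  refine ⟨φ, hφ, ?_⟩
  have h := h1.add h2
  rw [add_zero] at h
  refine tendsto_of_tendsto_of_tendsto_of_le_of_le tendsto_const_nhds h (fun _ => zero_le) fun n => ?_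
  have e : (F.grad (φ n) - fun x => F.frameGrad x.1 (Wu x) (Wl x)) = fun x =>
      F.frameGrad x.1 (partialU (φ n) x - Wu x) (partialL (φ n) x - Wl x) := by
    ext x
    simp [grad, frameGrad_sub]
  rw [e]
  exact F.eLpNorm_frameGrad_le
    ((continuous_partialU (hφ n).1).aestronglyMeasurable.sub hW.memLp_u.1)
    ((continuous_partialL (hφ n).1).aestronglyMeasurable.sub hW.memLp_l.1)

theorem IsSobolev.memLp_frameGrad {F : Fracture} {W Wu Wl : ℝ × ℝ → ℝ} (hW : F.IsSobolev W Wu Wl) :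
    MemLp (fun x => F.frameGrad x.1 (Wu x) (Wl x)) (3 / 2) F.vol :=
  F.memLp_frameGrad hW.memLp_u hW.memLp_l

/-! ### Functions that do not depend on `λ` -/

theorem integral_partialL_eq_zero {ψ : ℝ × ℝ → ℝ} (hψ : ContDiff ℝ ∞ ψ)
    (hc : HasCompactSupport ψ) (u : ℝ) : ∫ y, partialL ψ (u, y) = 0 := by
  have hemb : IsClosedEmbedding fun y : ℝ => (u, y) :=
    (Isometry.of_dist_eq fun a b => by simp [Prod.dist_eq]).isClosedEmbedding
  have hd : ∀ y, HasDerivAt (fun y => ψ (u, y)) (partialL ψ (u, y)) y := fun y => by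
    simpa using hasDerivAt_comp_prodMk hψ (hasDerivAt_const y u) (hasDerivAt_id y)
  refine integral_eq_zero_of_hasDerivAt_of_integrable hd ?_ ?_
  · exact Continuous.integrable_of_hasCompactSupport
      ((continuous_partialL hψ).comp hemb.continuous)
      ((hc.fderiv_apply ℝ (0, 1)).comp_isClosedEmbedding hemb)
  · exact Continuous.integrable_of_hasCompactSupport (hψ.continuous.comp hemb.continuous)
      (hc.comp_isClosedEmbedding hemb)

/-- Against a test function, $\int V_\lambda\psi=-\int v(u)\,\psi_\lambda$, and by Fubini the right
side vanishes because $\psi_\lambda$ has zero integral on every vertical line. -/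
theorem ae_eq_zero_of_indep {V Vu Vl : ℝ × ℝ → ℝ} (hV : F.IsSobolev V Vu Vl)
    (hind : ∃ v : ℝ → ℝ, V =ᵐ[F.vol] fun x => v x.1) : Vl =ᵐ[F.vol] 0 := by
  obtain ⟨v, hv⟩ := hind
  have hint : IntegrableOn Vl F.domain := by
    have : IsFiniteMeasure (volume.restrict F.domain) :=
      isFiniteMeasure_of_le F.vol F.volume_restrict_le_vol
    exact (hV.memLp_l.mono_measure F.volume_restrict_le_vol).integrable
      ENNReal.one_le_three_div_two
  have h := F.isOpen_domain.ae_eq_zero_of_integral_contDiff_smul_eq_zero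
    hint.locallyIntegrableOn (fun ψ hψ hc hs => ?_)
  · exact F.ae_vol_iff_ae_domain.2 ((ae_restrict_iff' F.measurableSet_domain).2 h)
  · have hweak := hV.weak_l ψ hψ hc hs
    have hz : ∀ x, x ∉ F.domain → ψ x = 0 := fun x hx =>
      image_eq_zero_of_notMem_tsupport fun h => hx (hs h)
    have hz' : ∀ x, x ∉ F.domain → partialL ψ x = 0 := fun x hx => by
      have : fderiv ℝ ψ x = 0 := image_eq_zero_of_notMem_tsupport
        fun h => hx (hs (tsupport_fderiv_subset ℝ h))
      simp [partialL, this]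
    have h0 : ∫ x in F.domain, V x * partialL ψ x = 0 := by
      have e : ∫ x in F.domain, V x * partialL ψ x = ∫ x in F.domain, v x.1 * partialL ψ x := by
        refine integral_congr_ae ?_
        filter_upwards [F.ae_vol_iff_ae_domain.1 hv] with x hx
        rw [hx]
      rw [e, setIntegral_eq_integral_of_forall_compl_eq_zero fun x hx => by simp [hz' x hx]]
      -- Fubini needs integrability; without it the Bochner integral is $0$ by convention, so the
      -- claim holds in both cases.
      by_cases hi : Integrable fun x : ℝ × ℝ => v x.1 * partialL ψ x
      · rw [Measure.volume_eq_prod] at hi ⊢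
        rw [integral_prod _ hi]
        simp [integral_const_mul, integral_partialL_eq_zero hψ hc]
      · exact integral_undef hi
    rw [h0, zero_eq_neg] at hweak
    rw [← hweak, setIntegral_eq_integral_of_forall_compl_eq_zero fun x hx => by simp [hz x hx]]
    simp [mul_comm]

end Fracture

/-! ### A priori bounds and the main estimate -/

/-- Divide by $A$ and absorb: $b\sqrt A\le\tfrac12(b^2+A)$. Finiteness of $A$ is essential. -/
theorem ENNReal.le_of_sq_le_add_sqrt_mul {A a b : ℝ≥0∞} (hA : A ≠ ⊤)
    (h : A ^ 2 ≤ (a + b * A ^ (1 / 2 : ℝ)) * A) : A ≤ 2 * a + b ^ 2 := by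
  rcases eq_or_ne a ⊤ with rfl | ha
  · simp
  rcases eq_or_ne b ⊤ with rfl | hb
  · simp
  rcases eq_or_ne A 0 with rfl | hA0
  · simp
  have h' : A ≤ a + b * A ^ (1 / 2 : ℝ) := by
    rw [sq] at h
    exact (ENNReal.mul_le_mul_iff_left hA0 hA).1 h
  lift A to ℝ≥0 using hA
  lift a to ℝ≥0 using ha
  lift b to ℝ≥0 using hb
  rw [← ENNReal.coe_rpow_of_nonneg _ (by norm_num)] at h'
  norm_cast at h' ⊢
  rw [← NNReal.coe_le_coe] at h' ⊢
  push_cast at h' ⊢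
  rw [← Real.sqrt_eq_rpow] at h'
  have h1 := Real.sq_sqrt A.coe_nonneg
  nlinarith [sq_nonneg ((b : ℝ) - √A)]

/-- Coercivity is applied to $Y$ and $0$. The weight involves the flux of $Y$ itself, but only
through $\|Y\|_{3/2}^{1/2}$, so it can be absorbed. -/
theorem eLpNorm_le_of_enorm_integral_flux_le {X E : Type*} [MeasurableSpace X] {μ : Measure X}
    [NormedAddCommGroup E] [InnerProductSpace ℝ E] {α β : ℝ} (hα : 0 < α) (hβ : 0 < β)
    {Y : X → E} (hY : MemLp Y (3 / 2) μ) {K : ℝ≥0∞}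
    (h : ‖∫ x, inner ℝ (forchheimerFlux α β (Y x)) (Y x) ∂μ‖ₑ ≤ K * eLpNorm Y (3 / 2) μ) :
    eLpNorm Y (3 / 2) μ ≤ 2 * (2 * (ENNReal.ofReal α * μ univ ^ (1 / 3 : ℝ)) * K) +
      (2 * (ENNReal.ofReal β * ENNReal.ofReal (β ^ (-(1 / 2) : ℝ))) * K) ^ 2 := by
  refine ENNReal.le_of_sq_le_add_sqrt_mul hY.2.ne ?_
  have h1 := eLpNorm_sub_sq_le_forchheimer hα hβ hY (MemLp.zero' (ε := E))
  simp only [forchheimerFlux_zero, eLpNorm_zero', add_zero, sub_zero, Pi.sub_apply] at h1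
  have h2 : (Y - fun _ => 0) = Y := by
    ext
    simp
  rw [h2] at h1
  calc _ ≤ 2 * (ENNReal.ofReal α * μ univ ^ (1 / 3 : ℝ) + ENNReal.ofReal β *
        (ENNReal.ofReal (β ^ (-(1 / 2) : ℝ)) * eLpNorm Y (3 / 2) μ ^ (1 / 2 : ℝ)))
          * (K * eLpNorm Y (3 / 2) μ) := by
        refine h1.trans ?_
        gcongr
        exact eLpNorm_forchheimerFlux_le hα hβ Y
    _ = _ := by ring

namespace Fracture

variable (F : Fracture)

/-- The weak equation admits only smooth test functions. Since the flux lies in $L^3$, dual to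
$L^{3/2}$, the bound passes along the approximating sequence to $W$ itself. -/
theorem IsSobolev.enorm_integral_flux_le {F : Fracture} {α β : ℝ} (hα : 0 < α) (hβ : 0 < β)
    {W Wu Wl : ℝ × ℝ → ℝ} (hW : F.IsSobolev W Wu Wl) {K : ℝ≥0∞} (hK : K ≠ ⊤)
    (h : ∀ φ, F.IsTest φ → ‖F.energyForm α β Wu Wl φ‖ₑ ≤ K * eLpNorm (F.grad φ) (3 / 2) F.vol) :
    ‖∫ x, inner ℝ (forchheimerFlux α β (F.frameGrad x.1 (Wu x) (Wl x)))
      (F.frameGrad x.1 (Wu x) (Wl x)) ∂F.vol‖ₑ ≤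
      K * eLpNorm (fun x => F.frameGrad x.1 (Wu x) (Wl x)) (3 / 2) F.vol := by
  obtain ⟨φ, hφ, hlim⟩ := hW.exists_tendsto
  refine enorm_integral_inner_le_of_tendsto hK (memLp_forchheimerFlux hα hβ hW.memLp_frameGrad)
    hW.memLp_frameGrad (fun n => F.memLp_grad (hφ n)) hlim fun n => ?_
  rw [← energyForm_eq_integral_inner]
  exact h _ (hφ n)

/-- The differences of the two approximating sequences are test functions converging to $W-V$ in
gradient. -/
theorem IsSobolev.enorm_integral_flux_sub_le {F : Fracture} {α β : ℝ} (hα : 0 < α) (hβ : 0 < β)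
    {W Wu Wl V Vu Vl : ℝ × ℝ → ℝ} (hW : F.IsSobolev W Wu Wl) (hV : F.IsSobolev V Vu Vl)
    {K : ℝ≥0∞} (hK : K ≠ ⊤)
    (h : ∀ φ, F.IsTest φ → ‖F.energyForm α β Wu Wl φ - F.energyForm α β Vu Vl φ‖ₑ ≤
      K * eLpNorm (F.grad φ) (3 / 2) F.vol) :
    ‖∫ x, inner ℝ (forchheimerFlux α β (F.frameGrad x.1 (Wu x) (Wl x))
        - forchheimerFlux α β (F.frameGrad x.1 (Vu x) (Vl x)))
      (((fun x => F.frameGrad x.1 (Wu x) (Wl x)) - fun x => F.frameGrad x.1 (Vu x) (Vl x)) x)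
      ∂F.vol‖ₑ ≤ K * eLpNorm ((fun x => F.frameGrad x.1 (Wu x) (Wl x))
        - fun x => F.frameGrad x.1 (Vu x) (Vl x)) (3 / 2) F.vol := by
  obtain ⟨φ, hφ, hφl⟩ := hW.exists_tendsto
  obtain ⟨ψ, hψ, hψl⟩ := hV.exists_tendsto
  have hP := memLp_forchheimerFlux hα hβ hW.memLp_frameGrad
  have hR := memLp_forchheimerFlux hα hβ hV.memLp_frameGrad
  refine enorm_integral_inner_le_of_tendsto hK (hP.sub hR)
    (hW.memLp_frameGrad.sub hV.memLp_frameGrad)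
    (fun n => F.memLp_grad ((hφ n).sub (hψ n))) ?_ fun n => ?_
  · have hl := hφl.add hψl
    rw [add_zero] at hl
    refine tendsto_of_tendsto_of_tendsto_of_le_of_le tendsto_const_nhds hl (fun _ => zero_le)
      fun n => ?_
    rw [F.grad_sub (hφ n) (hψ n), sub_sub_sub_comm]
    exact eLpNorm_sub_le ((F.memLp_grad (hφ n)).1.sub hW.memLp_frameGrad.1)
      ((F.memLp_grad (hψ n)).1.sub hV.memLp_frameGrad.1) ENNReal.one_le_three_div_two
  · have hg := F.memLp_grad ((hφ n).sub (hψ n))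
    refine le_trans (le_of_eq ?_) (h _ ((hφ n).sub (hψ n)))
    rw [energyForm_eq_integral_inner, energyForm_eq_integral_inner,
      ← integral_sub (integrable_inner_of_memLp hP hg) (integrable_inner_of_memLp hR hg)]
    simp only [inner_sub_left]

/-- The energy forms of the actual and of the reduced solution are bounded functionals of the
gradient, and so is their difference, with a norm controlled by the fluxes. -/
theorem exists_energyForm_bounds : ∃ C : ℝ≥0, ∀ (α β Q volΩ : ℝ) (qp qm : ℝ → ℝ),
    MemLp qp 3 (volume.restrict (Ioo 0 F.L)) → MemLp qm 3 (volume.restrict (Ioo 0 F.L)) →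
    ∀ a b : ℝ≥0∞, a ≠ ⊤ → b ≠ ⊤ → eLpNorm (fun x : ℝ × ℝ => qp x.1) 3 F.vol = a →
    eLpNorm (fun x : ℝ × ℝ => qm x.1) 3 F.vol = b →
    ∀ W Wu Wl V Vu Vl : ℝ × ℝ → ℝ, F.IsActualSolution α β Q volΩ qp qm W Wu Wl →
    F.IsReducedSolution α β Q volΩ qp qm V Vu Vl → ∀ φ, F.IsTest φ →
      ‖F.energyForm α β Wu Wl φ‖ₑ ≤
        C * (‖Q / volΩ‖ₑ + a + b) * eLpNorm (F.grad φ) (3 / 2) F.vol ∧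
      ‖F.energyForm α β Vu Vl φ‖ₑ ≤
        C * (‖Q / volΩ‖ₑ + a + b) * eLpNorm (F.grad φ) (3 / 2) F.vol ∧
      ‖F.energyForm α β Wu Wl φ - F.energyForm α β Vu Vl φ‖ₑ ≤
        C * (a + b) * eLpNorm (F.grad φ) (3 / 2) F.vol := by
  obtain ⟨C₁, hC₁⟩ := F.exists_enorm_edgeIntegral_le
  obtain ⟨C₂, hC₂⟩ := F.exists_lintegral_source_le
  obtain ⟨C₃, hC₃⟩ := F.exists_lintegral_test_le
  refine ⟨C₁ + C₂ + C₃, fun α β Q volΩ qp qm hqp hqm a b hat hbt ha hb W Wu Wl V Vu Vl hW hV φ hφ =>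
    ?_⟩
  have hN : eLpNorm (F.grad φ) (3 / 2) F.vol ≠ ⊤ := (F.memLp_grad hφ).2.ne
  set N := eLpNorm (F.grad φ) (3 / 2) F.vol
  set k := Q / volΩ
  have ep := hC₁ qp hqp.1 1 (by norm_num) φ hφ
  have em := hC₁ qm hqm.1 (-1) (by norm_num) φ hφ
  have sp := hC₂ qp hqp.1 φ hφ
  have sm := hC₂ qm hqm.1 φ hφ
  have st := hC₃ k φ hφ
  rw [ha] at ep sp
  rw [hb] at em sm
  have hmeas : ∀ q : ℝ → ℝ, AEStronglyMeasurable q (volume.restrict (Ioo 0 F.L)) →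
      AEStronglyMeasurable (fun x : ℝ × ℝ => q x.1 / (2 * F.h x.1) * φ x) F.vol := fun q hq => by
    have hh : Measurable fun x : ℝ × ℝ => 2 * F.h x.1 := by
      have := F.continuous_h
      fun_prop
    exact ((hq.comp_quasiMeasurePreserving F.quasiMeasurePreserving_fst).aemeasurable.div
      hh.aemeasurable).aestronglyMeasurable.mul hφ.1.continuous.aestronglyMeasurable
  have ip : Integrable (fun x : ℝ × ℝ => qp x.1 / (2 * F.h x.1) * φ x) F.vol :=
    ⟨hmeas qp hqp.1, sp.trans_lt (ENNReal.mul_lt_top (ENNReal.mul_lt_top (by simp) hat.lt_top)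
      hN.lt_top)⟩
  have im : Integrable (fun x : ℝ × ℝ => qm x.1 / (2 * F.h x.1) * φ x) F.vol :=
    ⟨hmeas qm hqm.1, sm.trans_lt (ENNReal.mul_lt_top (ENNReal.mul_lt_top (by simp) hbt.lt_top)
      hN.lt_top)⟩
  have it : Integrable (fun x : ℝ × ℝ => k * φ x) F.vol :=
    ⟨(hφ.1.continuous.const_mul k).aestronglyMeasurable,
      st.trans_lt (ENNReal.mul_lt_top (ENNReal.mul_lt_top (by simp) (by simp)) hN.lt_top)⟩
  have itp : Integrable (fun x : ℝ × ℝ => k * φ x + qp x.1 / (2 * F.h x.1) * φ x) F.vol :=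
    it.add ip
  have eV : F.energyForm α β Vu Vl φ = (∫ x, k * φ x ∂F.vol)
      + ∫ x, qp x.1 / (2 * F.h x.1) * φ x ∂F.vol + ∫ x, qm x.1 / (2 * F.h x.1) * φ x ∂F.vol := by
    rw [hV.weak_eq φ hφ, ← integral_add it ip,
      ← integral_add itp im]
    refine integral_congr_ae (ae_of_all _ fun x => ?_)
    ring
  have eW := hW.weak_eq φ hφ
  replace sp := (enorm_integral_le_lintegral_enorm _).trans sp
  replace sm := (enorm_integral_le_lintegral_enorm _).trans sm
  replace st := (enorm_integral_le_lintegral_enorm _).trans st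
  rw [eV, eW]
  push_cast
  refine ⟨?_, ?_, ?_⟩
  · calc _ ≤ C₃ * ‖k‖ₑ * N + C₁ * a * N + C₁ * b * N :=
          (enorm_add_le _ _).trans (add_le_add ((enorm_add_le _ _).trans (add_le_add st ep)) em)
      _ ≤ (C₁ + C₂ + C₃) * ‖k‖ₑ * N + (C₁ + C₂ + C₃) * a * N + (C₁ + C₂ + C₃) * b * N := by
          gcongr
          · exact le_add_self
          · exact le_self_add.trans le_self_add
          · exact le_self_add.trans le_self_add
      _ = _ := by ring
  · calc _ ≤ C₃ * ‖k‖ₑ * N + C₂ * a * N + C₂ * b * N :=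
          (enorm_add_le _ _).trans (add_le_add ((enorm_add_le _ _).trans (add_le_add st sp)) sm)
      _ ≤ (C₁ + C₂ + C₃) * ‖k‖ₑ * N + (C₁ + C₂ + C₃) * a * N + (C₁ + C₂ + C₃) * b * N := by
          gcongr
          · exact le_add_self
          · exact le_add_self.trans le_self_add
          · exact le_add_self.trans le_self_add
      _ = _ := by ring
  -- The $Q$ term cancels. Each edge integral and its averaged source are bounded separately; no
  -- cancellation between them is needed.
  · rw [show ∀ t e e' s s' : ℝ, t + e + e' - (t + s + s') = (e - s) + (e' - s') by
      intros; ring]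
    calc _ ≤ (C₁ * a * N + C₂ * a * N) + (C₁ * b * N + C₂ * b * N) :=
          (enorm_add_le _ _).trans (add_le_add (enorm_sub_le.trans (add_le_add ep sp))
            (enorm_sub_le.trans (add_le_add em sm)))
      _ = (C₁ + C₂) * (a + b) * N := by ring
      _ ≤ _ := mul_le_mul' (mul_le_mul' le_self_add le_rfl) le_rfl

end Fracture

theorem ENNReal.add_sq_le_two_mul (a b : ℝ≥0∞) : (a + b) ^ 2 ≤ 2 * (a ^ 2 + b ^ 2) := by
  have h := ENNReal.rpow_add_le_mul_rpow_add_rpow a b (p := 2) (by norm_num)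
  norm_num at h
  exact h

theorem theorem4p1 (F : Fracture) (α β Q volΩ : ℝ) (hα : 0 < α) (hβ : 0 < β) (hΩ : 0 < volΩ)
    (M : ℝ≥0) :
    ∃ C : ℝ≥0, ∀ qp qm : ℝ → ℝ,
      MemLp qp 3 (volume.restrict (Ioo 0 F.L)) →
      MemLp qm 3 (volume.restrict (Ioo 0 F.L)) →
      eLpNorm (fun x : ℝ × ℝ => qp x.1) 3 F.vol ≤ M →
      eLpNorm (fun x : ℝ × ℝ => qm x.1) 3 F.vol ≤ M →
      ∀ W Wu Wl V Vu Vl : ℝ × ℝ → ℝ,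
        F.IsActualSolution α β Q volΩ qp qm W Wu Wl →
        F.IsReducedSolution α β Q volΩ qp qm V Vu Vl →
        eLpNorm (fun x => F.gNorm x.1 (F.gGradU x.1 (Wu x - Vu x))) (3 / 2) F.vol ^ 2
            + eLpNorm Wl (3 / 2) F.vol ^ 2
          ≤ C * (eLpNorm (fun x : ℝ × ℝ => qp x.1) 3 F.vol ^ 2
            + eLpNorm (fun x : ℝ × ℝ => qm x.1) 3 F.vol ^ 2) := by
  obtain ⟨C, hC⟩ := F.exists_energyForm_bounds
  -- Here $K$ bounds both load functionals when $\|q^\pm\|_3\le M$, $R$ is the resulting a priori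
  -- bound for both gradients, and $D$ bounds the $L^3$ norm of the coercivity weight. None of them
  -- depends on $q^\pm$.
  set K : ℝ≥0∞ := C * (‖Q / volΩ‖ₑ + M + M) with hKdef
  have hK : K ≠ ⊤ := ENNReal.mul_ne_top (by simp) (by simp)
  have hμ : F.vol univ ^ (1 / 3 : ℝ) ≠ ⊤ :=
    ENNReal.rpow_ne_top_of_nonneg (by norm_num) F.vol_univ_lt_top.ne
  set γ : ℝ≥0∞ := ENNReal.ofReal (β ^ (-(1 / 2) : ℝ)) with hγ
  set R : ℝ≥0∞ := 2 * (2 * (ENNReal.ofReal α * F.vol univ ^ (1 / 3 : ℝ)) * K) +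
    (2 * (ENNReal.ofReal β * γ) * K) ^ 2 with hRdef
  have hR : R ≠ ⊤ := by finiteness
  set D : ℝ≥0∞ := 2 * (ENNReal.ofReal α * F.vol univ ^ (1 / 3 : ℝ) + ENNReal.ofReal β *
    (γ * R ^ (1 / 2 : ℝ) + γ * R ^ (1 / 2 : ℝ))) with hDdef
  have hR' : R ^ (1 / 2 : ℝ) ≠ ⊤ := ENNReal.rpow_ne_top_of_nonneg (by norm_num) hR
  have hD : D ≠ ⊤ := by finiteness
  -- A factor $2$ for the two terms on the left, and another from $(a+b)^2\le2(a^2+b^2)$.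
  have hCt : 4 * (D * C) ^ 2 ≠ ⊤ := by finiteness
  refine ⟨(4 * (D * C) ^ 2).toNNReal, fun qp qm hqp hqm hp hm W Wu Wl V Vu Vl hW hV => ?_⟩
  rw [ENNReal.coe_toNNReal hCt]
  have hat := (hp.trans_lt ENNReal.coe_lt_top).ne
  have hbt := (hm.trans_lt ENNReal.coe_lt_top).ne
  have hb := hC α β Q volΩ qp qm hqp hqm _ _ hat hbt rfl rfl W Wu Wl V Vu Vl hW hV
  set a := eLpNorm (fun x : ℝ × ℝ => qp x.1) 3 F.vol
  set b := eLpNorm (fun x : ℝ × ℝ => qm x.1) 3 F.vol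
  set X : ℝ × ℝ → ℂ := fun x => F.frameGrad x.1 (Wu x) (Wl x) with hXdef
  set Y : ℝ × ℝ → ℂ := fun x => F.frameGrad x.1 (Vu x) (Vl x) with hYdef
  have hX : MemLp X (3 / 2) F.vol := hW.sobolev.memLp_frameGrad
  have hY : MemLp Y (3 / 2) F.vol := hV.sobolev.memLp_frameGrad
  have hbK : ∀ N : ℝ≥0∞, C * (‖Q / volΩ‖ₑ + a + b) * N ≤ K * N := fun N => by
    rw [hKdef]
    gcongr
  have hXR : eLpNorm X (3 / 2) F.vol ≤ R :=
    eLpNorm_le_of_enorm_integral_flux_le hα hβ hX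
      (hW.sobolev.enorm_integral_flux_le hα hβ hK fun φ hφ => (hb φ hφ).1.trans (hbK _))
  have hYR : eLpNorm Y (3 / 2) F.vol ≤ R :=
    eLpNorm_le_of_enorm_integral_flux_le hα hβ hY
      (hV.sobolev.enorm_integral_flux_le hα hβ hK fun φ hφ => (hb φ hφ).2.1.trans (hbK _))
  have hpair := hW.sobolev.enorm_integral_flux_sub_le hα hβ hV.sobolev
    (ENNReal.mul_ne_top (by simp) (ENNReal.add_ne_top.2 ⟨hat, hbt⟩)) fun φ hφ => (hb φ hφ).2.2
  have hsq := eLpNorm_sub_sq_le_forchheimer hα hβ hX hY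
  have hflux : ∀ {Z : ℝ × ℝ → ℂ}, eLpNorm Z (3 / 2) F.vol ≤ R →
      eLpNorm (fun x => forchheimerFlux α β (Z x)) 3 F.vol ≤ γ * R ^ (1 / 2 : ℝ) := fun hZ =>
    (eLpNorm_forchheimerFlux_le hα hβ _).trans (by gcongr)
  have hZt : eLpNorm (X - Y) (3 / 2) F.vol ≠ ⊤ := (hX.sub hY).2.ne
  have hZ : eLpNorm (X - Y) (3 / 2) F.vol ≤ D * C * (a + b) := by
    set Z := eLpNorm (X - Y) (3 / 2) F.vol
    rcases eq_or_ne Z 0 with h0 | h0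
    · rw [h0]
      exact zero_le
    have h1 : Z * Z ≤ D * C * (a + b) * Z := by
      rw [← sq]
      calc _ ≤ D * (C * (a + b) * Z) := by
            refine hsq.trans ?_
            rw [hDdef]
            gcongr
            exacts [hflux hXR, hflux hYR]
        _ = _ := by ring
    exact (ENNReal.mul_le_mul_iff_left h0 hZt).1 h1
  have hU : eLpNorm (fun x => F.gNorm x.1 (F.gGradU x.1 (Wu x - Vu x))) (3 / 2) F.vol ≤
      eLpNorm (X - Y) (3 / 2) F.vol := by
    refine eLpNorm_mono fun x => ?_
    rw [F.gNorm_gGradU, norm_norm, Pi.sub_apply, hXdef, hYdef, ← F.frameGrad_sub]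
    exact F.norm_frameGrad_zero_le _ _ _
  have hL : eLpNorm Wl (3 / 2) F.vol ≤ eLpNorm (X - Y) (3 / 2) F.vol := by
    refine eLpNorm_mono_ae ?_
    filter_upwards [F.ae_eq_zero_of_indep hV.sobolev hV.indep] with x hx
    rw [Pi.sub_apply, hXdef, hYdef, ← F.frameGrad_sub, hx, Pi.zero_apply, sub_zero]
    exact F.abs_snd_le_norm_frameGrad _ _ _
  calc _ ≤ (D * C * (a + b)) ^ 2 + (D * C * (a + b)) ^ 2 := by
        gcongr
        exacts [hU.trans hZ, hL.trans hZ]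
    _ = 2 * (D * C) ^ 2 * (a + b) ^ 2 := by ring
    _ ≤ 2 * (D * C) ^ 2 * (2 * (a ^ 2 + b ^ 2)) := by
        gcongr
        exact ENNReal.add_sq_le_two_mul a b
    _ = _ := by ring
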